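/- Let $X$ be a complex Banach space and let $(C(t))_{t\in\mathbb R}$ be a cosine function on $X$, i.e. a strongly continuous family of bounded linear operators on $X$ with $C(0)=I$ and $C(t+s)+C(t-s)=2C(t)C(s)$ for all $t,s\in\mathbb R$. Let $(A,D(A))$ be its generator: $D(A)$ is the set of those $x\in X$ for which $Ax:=\lim_{t\to 0}\frac{2}{t^2}(C(t)x-x)$ exists in $X$. The powers $A^n$ are taken with their natural domains ($A^0=I$, $A^{n+1}=A\circ A^n$). Put $$S(t)x:=\int_0^tC(s)x\,ds\quad(t\in\mathbb R),\qquad T^{(c)}(z)x:=\frac1{\sqrt{\pi z}}\int_0^\infty e^{-t^2/(4z)}C(t)x\,dt\quad(\Re z>0)$$ for $x\in X$, with the principal square root, and, for integers $n\ge 0$ and $t\in\mathbb R$, $$H_n(t):=(-1)^ne^{t^2}\frac{d^n}{dt^n}(e^{-t^2}),\qquad h_n(t):=\frac{1}{2^nn!\sqrt\pi}e^{-t^2}H_n(t).$$ Then the integral defining $T^{(c)}(z)x$ and the integrals $\int_{-\infty}^{\infty}h_n(t)C(t)x\,dt$, $\int_{-\infty}^{\infty}h_n(t)S(t)x\,dt$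 converge absolutely, $T^{(c)}(\tfrac14)x\in D(A^n)$ for all $n\ge 0$ and $x\in X$, and the following hold. (i) For all $n\ge 0$ and $x\in X$, $$\int_{-\infty}^{\infty}h_{2n+1}(t)C(t)x\,dt=\int_{-\infty}^{\infty}h_{2n}(t)S(t)x\,dt=0,$$ $$\int_{-\infty}^{\infty}h_{2n}(t)C(t)x\,dt=\frac{1}{2^{2n}(2n)!}A^nT^{(c)}\Bigl(\frac14\Bigr)x,\qquad \int_{-\infty}^{\infty}h_{2n+1}(t)S(t)x\,dt=\frac{1}{2^{2n+1}(2n+1)!}A^nT^{(c)}\Bigl(\frac14\Bigr)x.$$ If $\sup_{t\in\mathbb R}\|C(t)\|<\infty$, then for all $n\ge 0$ and $x\in X$ $$\Bigl\|A^nT^{(c)}\Bigl(\frac14\Bigr)x\Bigr\|\le\Bigl(\sup_{t\in\mathbb R}\|C(t)\|\Bigr)\,2^n\sqrt{(2n)!}\,\|x\|.$$ (ii) For all $x\in D(A)$ and $t\in\mathbb R$, with convergence of the partial sums in the norm of $X$, $$C(t)x=\sum_{n=0}^\infty\frac{1}{2^{2n}(2n)!}A^nT^{(c)}\Bigl(\frac14\Bigr)x\,H_{2n}(t),\qquad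 S(t)x=\sum_{n=0}^\infty\frac{1}{2^{2n+1}(2n+1)!}A^nT^{(c)}\Bigl(\frac14\Bigr)x\,H_{2n+1}(t).$$ (iii) If $\sup_{t\in\mathbb R}\|C(t)\|<\infty$, then for all $x\in X$ and all $z\in\mathbb C$ with $|z-\frac14|<\frac14$, with convergence of the partial sums in the norm of $X$, $$T^{(c)}(z)x=\sum_{n=0}^\infty\frac{1}{2^{2n}n!}A^nT^{(c)}\Bigl(\frac14\Bigr)x\,(4z-1)^n.$$ -/

import Mathlib

open Filter Topology MeasureTheory

noncomputable section

namespace HermiteCosine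

/-- The Hermite polynomial `H_n` (physicists' normalization), given by Rodrigues' formula. -/
def hermiteH (n : ℕ) (t : ℝ) : ℝ :=
  (-1) ^ n * Real.exp (t ^ 2) * iteratedDeriv n (fun s : ℝ => Real.exp (-s ^ 2)) t

/-- The function `h_n(t) = e^{-t²} H_n(t) / (2^n n! √π)`. -/
def hermiteh (n : ℕ) (t : ℝ) : ℝ :=
  1 / (2 ^ n * (n.factorial : ℝ) * Real.sqrt Real.pi) * Real.exp (-t ^ 2) * hermiteH n t

variable {X : Type*} [NormedAddCommGroup X] [NormedSpace ℂ X]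

/-- `C` is a (strongly continuous) cosine function on `X`. -/
structure IsCosineFunction (C : ℝ → X →L[ℂ] X) : Prop where
  map_zero : C 0 = 1
  map_add_add_map_sub : ∀ t s : ℝ, C (t + s) + C (t - s) = (2 : ℂ) • (C t * C s)
  continuous_apply : ∀ x : X, Continuous fun t : ℝ => C t x

/-- `y = lim_{t → 0, t ≠ 0} (2 / t²) (C(t) x - x)`, the limit being taken in the norm of `X`. -/
def IsGeneratorValue (C : ℝ → X →L[ℂ] X) (x y : X) : Prop :=
  Tendsto (fun t : ℝ => (2 / t ^ 2 : ℝ) • (C t x - x)) (𝓝[≠] (0 : ℝ)) (𝓝 y)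

theorem IsGeneratorValue.unique {C : ℝ → X →L[ℂ] X} {x y y' : X}
    (h : IsGeneratorValue C x y) (h' : IsGeneratorValue C x y') : y = y' :=
  tendsto_nhds_unique h h'

theorem IsGeneratorValue.add {C : ℝ → X →L[ℂ] X} {x x' y y' : X}
    (h : IsGeneratorValue C x y) (h' : IsGeneratorValue C x' y') :
    IsGeneratorValue C (x + x') (y + y') := by
  refine (Tendsto.add h h').congr fun t => ?_
  rw [← smul_add, map_add]
  congr 1
  abel

theorem IsGeneratorValue.smul {C : ℝ → X →L[ℂ] X} {x y : X} (c : ℂ)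
    (h : IsGeneratorValue C x y) : IsGeneratorValue C (c • x) (c • y) := by
  refine (Tendsto.const_smul h c).congr fun t => ?_
  rw [smul_comm, map_smul, smul_sub]

theorem IsGeneratorValue.zero (C : ℝ → X →L[ℂ] X) : IsGeneratorValue C 0 0 := by
  refine tendsto_const_nhds.congr fun t => ?_
  simp

/-- The generator `(A, D(A))` of `C`: `D(A)` is the set of all `x` for which
`lim_{t → 0} (2 / t²) (C(t) x - x)` exists in `X`, and `A x` is this limit. -/
def generator (C : ℝ → X →L[ℂ] X) : X →ₗ.[ℂ] X where
  domain :=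
    { carrier := {x | ∃ y, IsGeneratorValue C x y}
      add_mem' := fun ⟨y, hy⟩ ⟨y', hy'⟩ => ⟨y + y', hy.add hy'⟩
      zero_mem' := ⟨0, IsGeneratorValue.zero C⟩
      smul_mem' := fun c _ ⟨y, hy⟩ => ⟨c • y, hy.smul c⟩ }
  toFun :=
    { toFun := fun x => x.2.choose
      map_add' := fun x x' =>
        (x + x').2.choose_spec.unique (x.2.choose_spec.add x'.2.choose_spec)
      map_smul' := fun c x => (c • x).2.choose_spec.unique (x.2.choose_spec.smul c) }

/-- The composition `B ∘ A` of unbounded operators, with its natural domain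
`{x ∈ D(A) : A x ∈ D(B)}`. -/
def opComp (B A : X →ₗ.[ℂ] X) : X →ₗ.[ℂ] X where
  domain :=
    { carrier := {x | ∃ h : x ∈ A.domain, A ⟨x, h⟩ ∈ B.domain}
      add_mem' := fun {x x'} ⟨h, hB⟩ ⟨h', hB'⟩ => ⟨A.domain.add_mem h h', by
        have e : A ⟨x + x', A.domain.add_mem h h'⟩ = A ⟨x, h⟩ + A ⟨x', h'⟩ :=
          A.map_add ⟨x, h⟩ ⟨x', h'⟩
        rw [e]; exact B.domain.add_mem hB hB'⟩
      zero_mem' := ⟨A.domain.zero_mem, by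
        have e : A ⟨0, A.domain.zero_mem⟩ = 0 := A.map_zero
        rw [e]; exact B.domain.zero_mem⟩
      smul_mem' := fun c x ⟨h, hB⟩ => ⟨A.domain.smul_mem c h, by
        have e : A ⟨c • x, A.domain.smul_mem c h⟩ = c • A ⟨x, h⟩ := A.map_smul c ⟨x, h⟩
        rw [e]; exact B.domain.smul_mem c hB⟩ }
  toFun :=
    { toFun := fun x => B ⟨A ⟨x.1, x.2.1⟩, x.2.2⟩
      map_add' := fun x x' => by
        rw [← B.map_add]
        exact congrArg B (Subtype.ext (A.map_add ⟨x.1, x.2.1⟩ ⟨x'.1, x'.2.1⟩))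
      map_smul' := fun c x => by
        rw [RingHom.id_apply, ← B.map_smul]
        exact congrArg B (Subtype.ext (A.map_smul c ⟨x.1, x.2.1⟩)) }

/-- The power `A^n` of an unbounded operator: `A^0 = I` on `X`, `A^{n+1} = A ∘ A^n`. -/
def opPow (A : X →ₗ.[ℂ] X) : ℕ → X →ₗ.[ℂ] X
  | 0 => (LinearMap.id : X →ₗ[ℂ] X).toPMap ⊤
  | n + 1 => opComp A (opPow A n)

/-- The sine function `S(t) x = ∫_0^t C(s) x ds` associated with `C`. -/
def sine (C : ℝ → X →L[ℂ] X) (t : ℝ) (x : X) : X := ∫ s in (0 : ℝ)..t, C s x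

/-- The integrand `t ↦ e^{-t²/(4z)} C(t) x` of the subordination formula. -/
def subordIntegrand (C : ℝ → X →L[ℂ] X) (z : ℂ) (x : X) (t : ℝ) : X :=
  Complex.exp (-(t : ℂ) ^ 2 / (4 * z)) • C t x

/-- The subordinated family
`T(z) x = (π z)^{-1/2} ∫_0^∞ e^{-t²/(4z)} C(t) x dt`, `Re z > 0`, with the principal root. -/
def subordSemigroup (C : ℝ → X →L[ℂ] X) (z : ℂ) (x : X) : X :=
  (1 / ((Real.pi : ℂ) * z) ^ (1 / 2 : ℂ)) • ∫ t in Set.Ioi (0 : ℝ), subordIntegrand C z x t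

end HermiteCosine

end

open HermiteCosine

/-! Every integral in the statement is a Hermite coefficient of an orbit `C t x` or `sine C t x`,
and these orbits grow only exponentially, so the Gaussian weight makes everything converge. Three
mechanisms carry the result.

Coefficients. By d'Alembert's equation, the second difference quotient of `C` acting on `∫ h_n C x`
moves onto the kernel `h_n`, and dominated convergence turns it into `h_n'' = 4(n+1)(n+2) h_{n+2}`.
Thus the generator shifts the index by two (`isGeneratorValue_integral_hermiteh`). Since `T(1/4) x`
is the coefficient of index `0`, induction gives `A^n T(1/4) x` (`exists_opPow_eq`). Parity kills
half of the coefficients, and integration by parts passes from `C` to `sine C`. The norm bound is `∫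
|h_n| ≤ (2^n n!)^{-1/2}`.

Expansion. Values in a general Banach space rule out Parseval, so pointwise convergence is proved
directly for C² functions (`tendsto_hermite_expansion`). The Christoffel-Darboux formula writes the
error of a partial sum as two Hermite coefficients of the divided difference of `f` at `t`. One
integration by parts bounds both by multiples of `H_n(t) / √(2^n n!)`, which tends to `0` by Sonin's
energy estimate and the Wallis-type decay at the origin. For `x ∈ D(A)` both orbits are C², because
`C(t) x = x + ∫_0^t S(s) A x ds` (`apply_eq_of_isGeneratorValue`).

Series in `z`. Expanding the Gaussian kernel of `T(z)` about `z = 1/4` gives a Mehler type series in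
the `h_{2n}` (`hasSum_hermiteh_even`), obtained on the Fourier side, where it is just the
exponential series. For bounded `C` it may be integrated term by term, by comparison with the
geometric series of ratio `|4z - 1|`. -/

noncomputable section

/-! ### Derivatives of the Gaussian and Hermite functions -/

/-- The `n`-th derivative of `t ↦ e^{-t²}`. -/
def gaussDeriv (n : ℕ) : ℝ → ℝ := iteratedDeriv n fun s : ℝ => Real.exp (-s ^ 2)

theorem gaussDeriv_zero (t : ℝ) : gaussDeriv 0 t = Real.exp (-t ^ 2) := by
  simp [gaussDeriv]

theorem hasDerivAt_gaussDeriv (n : ℕ) (t : ℝ) :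
    HasDerivAt (gaussDeriv n) (gaussDeriv (n + 1) t) t := by
  have h : ContDiff ℝ (⊤ : ℕ∞) fun s : ℝ => Real.exp (-s ^ 2) := by fun_prop
  have hd := (h.differentiable_iteratedDeriv n (by exact_mod_cast WithTop.coe_lt_top n)) t
  have := hd.hasDerivAt
  rwa [← iteratedDeriv_succ] at this

theorem continuous_gaussDeriv (n : ℕ) : Continuous (gaussDeriv n) :=
  continuous_iff_continuousAt.2 fun t => (hasDerivAt_gaussDeriv n t).continuousAt

theorem gaussDeriv_one (t : ℝ) : gaussDeriv 1 t = -2 * t * gaussDeriv 0 t := by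
  have h1 := hasDerivAt_gaussDeriv 0 t
  have h2 : HasDerivAt (gaussDeriv 0) (Real.exp (-t ^ 2) * (-(2 * t))) t := by
    have h3 : HasDerivAt (fun s : ℝ => -s ^ 2) (-(2 * t)) t := by
      simpa using (hasDerivAt_pow 2 t).fun_neg
    have h4 := h3.exp
    rwa [show (fun s : ℝ => Real.exp (-s ^ 2)) = gaussDeriv 0 from
      funext fun s => (gaussDeriv_zero s).symm] at h4
  have h3 := h1.unique h2
  rw [zero_add] at h3
  rw [h3, gaussDeriv_zero]
  ring

theorem gaussDeriv_add_two (n : ℕ) (t : ℝ) :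
    gaussDeriv (n + 2) t = -2 * t * gaussDeriv (n + 1) t - 2 * (n + 1) * gaussDeriv n t := by
  induction n generalizing t with
  | zero =>
    have h1 := hasDerivAt_gaussDeriv 1 t
    have h2 := ((hasDerivAt_id t).const_mul (-2)).mul (hasDerivAt_gaussDeriv 0 t)
    have h3 : gaussDeriv 1 = fun s => -2 * s * gaussDeriv 0 s := funext gaussDeriv_one
    rw [h3] at h1
    have := h1.unique h2
    simp only [id] at this
    norm_num at this ⊢
    rw [this, h3]
    ring
  | succ n ih =>
    have h1 := hasDerivAt_gaussDeriv (n + 2) t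
    have h2 := (((hasDerivAt_id t).const_mul (-2)).mul (hasDerivAt_gaussDeriv (n + 1) t)).sub
      ((hasDerivAt_gaussDeriv n t).const_mul (2 * ((n : ℝ) + 1)))
    have h3 : gaussDeriv (n + 2) =
      fun s => -2 * s * gaussDeriv (n + 1) s - 2 * (n + 1) * gaussDeriv n s := funext ih
    rw [h3] at h1
    have := h1.unique h2
    simp only [id] at this
    rw [show n + 1 + 2 = n + 2 + 1 by ring, this]
    push_cast
    ring

theorem gaussDeriv_neg (n : ℕ) (t : ℝ) : gaussDeriv n (-t) = (-1) ^ n * gaussDeriv n t := by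
  induction n using Nat.strong_induction_on generalizing t with
  | _ n ih =>
    match n with
    | 0 => simp [gaussDeriv_zero]
    | 1 => rw [gaussDeriv_one, gaussDeriv_one, ih 0 (by omega)]; ring
    | n + 2 =>
      rw [gaussDeriv_add_two, gaussDeriv_add_two, ih n (by omega), ih (n + 1) (by omega)]
      ring

theorem abs_mul_exp_neg_mul_sq_le {c d : ℝ} (h : c < d) (t : ℝ) :
    |t| * Real.exp (-d * t ^ 2) ≤ (1 + 1 / (d - c)) * Real.exp (-c * t ^ 2) := by
  have hd : 0 < d - c := sub_pos.2 h
  have e : Real.exp (-c * t ^ 2) = Real.exp ((d - c) * t ^ 2) * Real.exp (-d * t ^ 2) := by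
    rw [← Real.exp_add]; ring_nf
  rw [e, ← mul_assoc]
  refine mul_le_mul_of_nonneg_right ?_ (Real.exp_pos _).le
  have h1 := Real.add_one_le_exp ((d - c) * t ^ 2)
  have h2 : |t| ≤ 1 + t ^ 2 := by nlinarith [sq_abs t, sq_nonneg (|t| - 1), abs_nonneg t]
  calc |t| ≤ 1 + t ^ 2 := h2
    _ ≤ (1 + 1 / (d - c)) * ((d - c) * t ^ 2 + 1) := by
      have : (1 + 1 / (d - c)) * ((d - c) * t ^ 2 + 1) =
        1 + t ^ 2 + (1 / (d - c) + (d - c) * t ^ 2) := by field_simp; ring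
      rw [this]
      have : 0 ≤ 1 / (d - c) + (d - c) * t ^ 2 := by positivity
      linarith
    _ ≤ _ := by gcongr

/-- The factor `t` in the three-term recurrence costs a little of the exponent, so the induction
runs over all `c < 1` at once: the bound for index `n + 1` is taken at some `d` between `c` and `1`.
-/
theorem exists_abs_gaussDeriv_le (n : ℕ) {c : ℝ} (hc : c < 1) :
    ∃ K : ℝ, 0 ≤ K ∧ ∀ t, |gaussDeriv n t| ≤ K * Real.exp (-c * t ^ 2) := by
  induction n using Nat.strong_induction_on generalizing c with
  | _ n ih =>
    have base : ∀ t : ℝ, |gaussDeriv 0 t| ≤ 1 * Real.exp (-c * t ^ 2) := fun t => by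
      rw [gaussDeriv_zero, Real.abs_exp, one_mul]
      exact Real.exp_le_exp.2 (by nlinarith [sq_nonneg t])
    match n with
    | 0 => exact ⟨1, zero_le_one, base⟩
    | 1 =>
      refine ⟨2 * (1 + 1 / (1 - c)), ?_, fun t => ?_⟩
      · have := sub_pos.2 hc
        positivity
      · rw [gaussDeriv_one, gaussDeriv_zero, abs_mul, abs_mul, Real.abs_exp]
        have := abs_mul_exp_neg_mul_sq_le hc t
        norm_num at this ⊢
        linarith
    | n + 2 =>
      obtain ⟨d, hcd, hd⟩ := exists_between hc
      obtain ⟨K, hK, h⟩ := ih (n + 1) (by omega) hd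
      obtain ⟨L, hL, h'⟩ := ih n (by omega) hc
      refine ⟨2 * K * (1 + 1 / (d - c)) + 2 * (n + 1) * L, ?_, fun t => ?_⟩
      · have := sub_pos.2 hcd
        positivity
      · rw [gaussDeriv_add_two]
        refine (abs_sub _ _).trans ?_
        rw [abs_mul, abs_mul, abs_mul (2 * ((n : ℝ) + 1)), add_mul]
        refine add_le_add ?_ ?_
        · calc |(-2 : ℝ)| * |t| * |gaussDeriv (n + 1) t|
              ≤ 2 * |t| * (K * Real.exp (-d * t ^ 2)) := by
                norm_num
                exact mul_le_mul_of_nonneg_left (by simpa using h t) (by positivity)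
            _ = 2 * K * (|t| * Real.exp (-d * t ^ 2)) := by ring
            _ ≤ 2 * K * ((1 + 1 / (d - c)) * Real.exp (-c * t ^ 2)) := by
                exact mul_le_mul_of_nonneg_left (abs_mul_exp_neg_mul_sq_le hcd t) (by positivity)
            _ = _ := by ring
        · rw [abs_of_nonneg (by positivity : (0 : ℝ) ≤ 2 * (n + 1)), mul_assoc (2 * ((n : ℝ) + 1))]
          exact mul_le_mul_of_nonneg_left (h' t) (by positivity)

theorem hermiteH_eq (n : ℕ) (t : ℝ) :
    hermiteH n t = (-1) ^ n * Real.exp (t ^ 2) * gaussDeriv n t := rfl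

theorem hermiteh_eq (n : ℕ) (t : ℝ) :
    hermiteh n t = (-1) ^ n / (2 ^ n * (n.factorial : ℝ) * √Real.pi) * gaussDeriv n t := by
  rw [hermiteh, hermiteH_eq, Real.exp_neg]
  field_simp

theorem hermiteh_eq_mul_hermiteH (n : ℕ) (t : ℝ) :
    hermiteh n t =
      1 / (2 ^ n * (n.factorial : ℝ) * √Real.pi) * Real.exp (-t ^ 2) * hermiteH n t := rfl

theorem continuous_hermiteh (n : ℕ) : Continuous (hermiteh n) := by
  rw [show hermiteh n = _ from funext (hermiteh_eq n)]
  exact continuous_const.mul (continuous_gaussDeriv n)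

theorem continuous_hermiteH (n : ℕ) : Continuous (hermiteH n) := by
  rw [show hermiteH n = _ from funext (hermiteH_eq n)]
  have := continuous_gaussDeriv n
  fun_prop

theorem hasDerivAt_hermiteh (n : ℕ) (t : ℝ) :
    HasDerivAt (hermiteh n) (-2 * (n + 1) * hermiteh (n + 1) t) t := by
  have := (hasDerivAt_gaussDeriv n t).const_mul ((-1) ^ n / (2 ^ n * (n.factorial : ℝ) * √Real.pi))
  rw [← show hermiteh n = _ from funext (hermiteh_eq n)] at this
  refine this.congr_deriv ?_
  rw [hermiteh_eq, Nat.factorial_succ]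
  push_cast
  field_simp
  ring

theorem hermiteH_zero (t : ℝ) : hermiteH 0 t = 1 := by
  rw [hermiteH_eq, gaussDeriv_zero, pow_zero, one_mul, ← Real.exp_add]
  simp

theorem hermiteH_one (t : ℝ) : hermiteH 1 t = 2 * t := by
  have : Real.exp (t ^ 2) * Real.exp (-t ^ 2) = 1 := by rw [← Real.exp_add]; simp
  rw [hermiteH_eq, gaussDeriv_one, gaussDeriv_zero]
  linear_combination 2 * t * this

theorem hermiteH_add_two (n : ℕ) (t : ℝ) :
    hermiteH (n + 2) t = 2 * t * hermiteH (n + 1) t - 2 * (n + 1) * hermiteH n t := by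
  simp only [hermiteH_eq, gaussDeriv_add_two]
  ring

theorem hasDerivAt_hermiteH_succ (n : ℕ) (t : ℝ) :
    HasDerivAt (hermiteH (n + 1)) (2 * (n + 1) * hermiteH n t) t := by
  have h3 : HasDerivAt (fun s : ℝ => s ^ 2) (2 * t) t := by
    simpa using (hasDerivAt_pow 2 t)
  have h := (h3.exp.const_mul ((-1) ^ (n + 1))).mul (hasDerivAt_gaussDeriv (n + 1) t)
  change HasDerivAt (fun s => (-1) ^ (n + 1) * Real.exp (s ^ 2) * gaussDeriv (n + 1) s) _ t at h
  rw [← show hermiteH (n + 1) = _ from funext (hermiteH_eq (n + 1))] at h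
  refine h.congr_deriv ?_
  rw [gaussDeriv_add_two, hermiteH_eq]
  ring

theorem hasDerivAt_hermiteH (n : ℕ) (t : ℝ) :
    HasDerivAt (hermiteH n) (2 * n * hermiteH (n - 1) t) t := by
  cases n with
  | zero =>
    rw [show hermiteH 0 = fun _ => (1 : ℝ) from funext hermiteH_zero]
    simpa using hasDerivAt_const t (1 : ℝ)
  | succ n => simpa using hasDerivAt_hermiteH_succ n t

theorem hermiteh_neg (n : ℕ) (t : ℝ) : hermiteh n (-t) = (-1) ^ n * hermiteh n t := by
  rw [hermiteh_eq, hermiteh_eq, gaussDeriv_neg]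
  ring

theorem exists_abs_hermiteh_le (n : ℕ) :
    ∃ K : ℝ, 0 ≤ K ∧ ∀ t, |hermiteh n t| ≤ K * Real.exp (-(1 / 2) * t ^ 2) := by
  obtain ⟨K, hK, h⟩ := exists_abs_gaussDeriv_le n (c := 1 / 2) (by norm_num)
  refine ⟨|(-1) ^ n / (2 ^ n * (n.factorial : ℝ) * √Real.pi)| * K, by positivity, fun t => ?_⟩
  rw [hermiteh_eq, abs_mul, mul_assoc |_|]
  exact mul_le_mul_of_nonneg_left (h t) (abs_nonneg _)

theorem exists_abs_hermiteH_le (n : ℕ) :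
    ∃ K : ℝ, 0 ≤ K ∧ ∀ t, |hermiteH n t| ≤ K * Real.exp (1 / 8 * t ^ 2) := by
  obtain ⟨K, hK, h⟩ := exists_abs_gaussDeriv_le n (c := 7 / 8) (by norm_num)
  refine ⟨K, hK, fun t => ?_⟩
  rw [hermiteH_eq, abs_mul, abs_mul, abs_pow, abs_neg, abs_one, one_pow, one_mul, Real.abs_exp]
  calc _ ≤ Real.exp (t ^ 2) * (K * Real.exp (-(7 / 8) * t ^ 2)) := by gcongr; exact h t
    _ = K * (Real.exp (t ^ 2) * Real.exp (-(7 / 8) * t ^ 2)) := by ring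
    _ = _ := by rw [← Real.exp_add]; ring_nf

/-- The three-term recurrence makes the sum telescope. The left factor is the kernel of the `m`-th
partial sum of the Hermite expansion at `t`; multiplying by `s - t` leaves only two terms. -/
theorem christoffel_darboux (m : ℕ) (s t : ℝ) :
    (s - t) * ∑ k ∈ Finset.range (m + 1), hermiteH k t * hermiteh k s =
      (m + 1) * hermiteh (m + 1) s * hermiteH m t - 1 / 2 * hermiteh m s * hermiteH (m + 1) t := by
  induction m with
  | zero =>
    simp only [zero_add, Finset.sum_range_one, hermiteh_eq_mul_hermiteH, hermiteH_zero,
      hermiteH_one]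
    simp
    field_simp
  | succ m ih =>
    rw [Finset.sum_range_succ, mul_add, ih]
    simp only [hermiteh_eq_mul_hermiteH, hermiteH_add_two, Nat.factorial_succ]
    push_cast
    field_simp
    ring

/-! ### Hermite coefficients of functions of at most Gaussian growth -/

/-- A function on the line which grows at most like `e^{t²/8}`. -/
def SubGaussian {E : Type*} [NormedAddCommGroup E] (f : ℝ → E) : Prop :=
  ∃ K : ℝ, 0 ≤ K ∧ ∀ t, ‖f t‖ ≤ K * Real.exp (1 / 8 * t ^ 2)

section
variable {E : Type*} [NormedAddCommGroup E]

/-- Completing the square, `ω |t| ≤ t² / 8 + 2 ω²`. The rate `1/8` is small enough for `‖f‖²` to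
stay integrable against `e^{-t²}`, and `‖f‖` against `h_n = O(e^{-t²/2})`. -/
theorem SubGaussian.of_exp_bound {f : ℝ → E} {K ω : ℝ} (hK : 0 ≤ K)
    (h : ∀ t, ‖f t‖ ≤ K * Real.exp (ω * |t|)) : SubGaussian f := by
  refine ⟨K * Real.exp (2 * ω ^ 2), by positivity, fun t => (h t).trans ?_⟩
  rw [mul_assoc, ← Real.exp_add]
  gcongr
  nlinarith [sq_nonneg (|t| - 4 * ω), sq_abs t]

theorem SubGaussian.sub {f g : ℝ → E} (hf : SubGaussian f) (hg : SubGaussian g) :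
    SubGaussian fun t => f t - g t := by
  obtain ⟨K, hK, h⟩ := hf
  obtain ⟨L, hL, h'⟩ := hg
  refine ⟨K + L, by positivity, fun t => (norm_sub_le _ _).trans ?_⟩
  rw [add_mul]
  exact add_le_add (h t) (h' t)

theorem SubGaussian.const (c : E) : SubGaussian fun _ : ℝ => c :=
  .of_exp_bound (K := ‖c‖) (ω := 0) (norm_nonneg c) fun t => by simp

theorem subGaussian_hermiteH (n : ℕ) : SubGaussian (hermiteH n) := exists_abs_hermiteH_le n

theorem SubGaussian.integrable_exp_mul_sq {f : ℝ → E} (hf : SubGaussian f) (hc : Continuous f) :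
    Integrable fun t : ℝ => Real.exp (-t ^ 2) * ‖f t‖ ^ 2 := by
  obtain ⟨K, hK, h⟩ := hf
  refine ((integrable_exp_neg_mul_sq (b := 3 / 4) (by norm_num)).const_mul (K ^ 2)).mono'
    (by fun_prop) (ae_of_all _ fun t => ?_)
  rw [Real.norm_of_nonneg (by positivity)]
  calc Real.exp (-t ^ 2) * ‖f t‖ ^ 2
      ≤ Real.exp (-t ^ 2) * (K * Real.exp (1 / 8 * t ^ 2)) ^ 2 := by gcongr; exact h t
    _ = K ^ 2 * (Real.exp (-t ^ 2) * (Real.exp (1 / 8 * t ^ 2) * Real.exp (1 / 8 * t ^ 2))) := by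
      ring
    _ = _ := by
      rw [← Real.exp_add, ← Real.exp_add]
      ring_nf

variable [NormedSpace ℝ E]

theorem SubGaussian.integrable_hermiteh_smul {f : ℝ → E} (hf : SubGaussian f) (hc : Continuous f)
    (n : ℕ) : Integrable fun t => hermiteh n t • f t := by
  obtain ⟨K, hK, h⟩ := hf
  obtain ⟨L, hL, h'⟩ := exists_abs_hermiteh_le n
  refine ((integrable_exp_neg_mul_sq (b := 3 / 8) (by norm_num)).const_mul (L * K)).mono'
    ((continuous_hermiteh n).smul hc).aestronglyMeasurable (ae_of_all _ fun t => ?_)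
  rw [norm_smul, Real.norm_eq_abs]
  calc |hermiteh n t| * ‖f t‖
      ≤ (L * Real.exp (-(1 / 2) * t ^ 2)) * (K * Real.exp (1 / 8 * t ^ 2)) :=
        mul_le_mul (h' t) (h t) (norm_nonneg _) (by positivity)
    _ = L * K * (Real.exp (-(1 / 2) * t ^ 2) * Real.exp (1 / 8 * t ^ 2)) := by ring
    _ = _ := by
      rw [← Real.exp_add]
      ring_nf

theorem integrable_hermiteh (n : ℕ) : Integrable (hermiteh n) := by
  simpa using (SubGaussian.const (1 : ℝ)).integrable_hermiteh_smul continuous_const n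

/-- Integration by parts against `h_{n+1} = -h_n' / (2 (n + 1))`. -/
theorem integral_hermiteh_succ_smul {f f' : ℝ → E} (hd : ∀ t, HasDerivAt f (f' t) t)
    (hf : SubGaussian f) (hf' : SubGaussian f') (hc' : Continuous f') (n : ℕ) :
    ∫ t, hermiteh (n + 1) t • f t = (1 / (2 * ((n : ℝ) + 1))) • ∫ t, hermiteh n t • f' t := by
  have hc : Continuous f := continuous_iff_continuousAt.2 fun t => (hd t).continuousAt
  have i1 := hf.integrable_hermiteh_smul hc (n + 1)
  have i2 := hf'.integrable_hermiteh_smul hc' n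
  have i3 := hf.integrable_hermiteh_smul hc n
  have key := integral_eq_zero_of_hasDerivAt_of_integrable
    (fun t => (hasDerivAt_hermiteh n t).smul (hd t))
    (by
      refine i2.add ((i1.smul (-2 * ((n : ℝ) + 1))).congr (ae_of_all _ fun t => ?_))
      simp [mul_smul]) i3
  have e : ∀ t, (-2 * ((n : ℝ) + 1) * hermiteh (n + 1) t) • f t =
      (-2 * ((n : ℝ) + 1)) • (hermiteh (n + 1) t • f t) := fun t => mul_smul _ _ _
  simp only [e] at key
  rw [integral_add i2 (i1.fun_smul _), integral_smul] at key
  rw [eq_neg_of_add_eq_zero_left key, ← neg_smul, smul_smul]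
  have : 1 / (2 * ((n : ℝ) + 1)) * -(-2 * ((n : ℝ) + 1)) = 1 := by field_simp
  rw [this, one_smul]

theorem integral_hermiteh_zero : ∫ t, hermiteh 0 t = 1 := by
  have : ∀ t, hermiteh 0 t = 1 / √Real.pi * Real.exp (-1 * t ^ 2) := fun t => by
    simp [hermiteh, hermiteH_zero]
  simp only [this]
  rw [integral_const_mul, integral_gaussian, div_one]
  field_simp

theorem integral_hermiteh_succ (n : ℕ) : ∫ t, hermiteh (n + 1) t = 0 := by
  have := integral_hermiteh_succ_smul (fun t => hasDerivAt_const t (1 : ℝ)) (.const 1) (.const 0)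
    continuous_const n
  simpa using this

/-- Integration by parts lowers both indices, since `H_{n+1}' = 2(n+1) H_n`. Only this diagonal case
of biorthogonality is needed, to normalize the next estimate. -/
theorem integral_hermiteh_mul_hermiteH (n : ℕ) : ∫ t, hermiteh n t * hermiteH n t = 1 := by
  induction n with
  | zero => simp [hermiteH_zero, integral_hermiteh_zero]
  | succ n ih =>
    obtain ⟨K, hK, h⟩ := subGaussian_hermiteH n
    have := integral_hermiteh_succ_smul (f' := fun t => 2 * ((n : ℝ) + 1) * hermiteH n t)
      (hasDerivAt_hermiteH_succ n) (subGaussian_hermiteH (n + 1))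
      ⟨2 * ((n : ℝ) + 1) * K, by positivity, fun t => by
        rw [norm_mul, Real.norm_of_nonneg (by positivity), mul_assoc (2 * ((n : ℝ) + 1))]
        exact mul_le_mul_of_nonneg_left (h t) (by positivity)⟩
      (continuous_const.mul (continuous_hermiteH n)) n
    simp only [smul_eq_mul] at this
    rw [this]
    have e : ∀ t, hermiteh n t * (2 * ((n : ℝ) + 1) * hermiteH n t) =
      (2 * ((n : ℝ) + 1)) * (hermiteh n t * hermiteH n t) := fun t => by ring
    simp only [e]
    rw [integral_const_mul, ih]
    field_simp

/-- The normalizing constant `√(2^n n!)` of the Hermite polynomials. -/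
def hermiteNorm (n : ℕ) : ℝ := √(2 ^ n * (n.factorial : ℝ))

theorem hermiteNorm_pos (n : ℕ) : 0 < hermiteNorm n := Real.sqrt_pos.2 (by positivity)

theorem sq_hermiteNorm (n : ℕ) : hermiteNorm n ^ 2 = 2 ^ n * (n.factorial : ℝ) :=
  Real.sq_sqrt (by positivity)

/-- A substitute for Cauchy-Schwarz: the pointwise inequality `ab ≤ (a² + b²) / 2` with `a = |H_n| /
√(2^n n!)`, `b = ‖f‖`, integrated against `e^{-t²} / √π`. What matters is the factor `1 / √(2^n
n!)`; the other factor does not depend on `n`. -/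
theorem integral_abs_hermiteh_mul_norm_le {f : ℝ → E} (hf : SubGaussian f) (hc : Continuous f)
    (n : ℕ) : ∫ t, |hermiteh n t| * ‖f t‖ ≤
      1 / hermiteNorm n *
        (1 / 2 * (1 + 1 / √Real.pi * ∫ t : ℝ, Real.exp (-t ^ 2) * ‖f t‖ ^ 2)) := by
  have hN := hermiteNorm_pos n
  have i1 := (hf.integrable_hermiteh_smul hc n).norm
  have i2 : Integrable fun t => hermiteh n t * hermiteH n t :=
    (subGaussian_hermiteH n).integrable_hermiteh_smul (continuous_hermiteH n) n
  have i3 := hf.integrable_exp_mul_sq hc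
  have hle : ∀ t, |hermiteh n t| * ‖f t‖ ≤
      1 / hermiteNorm n * (1 / 2 * (hermiteh n t * hermiteH n t +
        1 / √Real.pi * (Real.exp (-t ^ 2) * ‖f t‖ ^ 2))) := fun t => by
    have h1 : |hermiteh n t| =
        1 / (hermiteNorm n ^ 2 * √Real.pi) * Real.exp (-t ^ 2) * |hermiteH n t| := by
      rw [hermiteh_eq_mul_hermiteH, abs_mul, sq_hermiteNorm, abs_of_nonneg (by positivity)]
    have h2 : hermiteh n t * hermiteH n t =
        1 / (hermiteNorm n ^ 2 * √Real.pi) * Real.exp (-t ^ 2) * |hermiteH n t| ^ 2 := by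
      rw [hermiteh_eq_mul_hermiteH, sq_hermiteNorm, sq_abs]
      ring
    rw [h1, h2]
    have h3 : 0 ≤ Real.exp (-t ^ 2) / √Real.pi * (|hermiteH n t| / hermiteNorm n - ‖f t‖) ^ 2 := by
      positivity
    have h4 : 1 / hermiteNorm n * (1 / 2 *
        (1 / (hermiteNorm n ^ 2 * √Real.pi) * Real.exp (-t ^ 2) * |hermiteH n t| ^ 2 +
        1 / √Real.pi * (Real.exp (-t ^ 2) * ‖f t‖ ^ 2))) -
        1 / (hermiteNorm n ^ 2 * √Real.pi) * Real.exp (-t ^ 2) * |hermiteH n t| * ‖f t‖ =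
        1 / hermiteNorm n * (1 / 2 *
        (Real.exp (-t ^ 2) / √Real.pi * (|hermiteH n t| / hermiteNorm n - ‖f t‖) ^ 2)) := by
      field_simp
      ring
    rw [← sub_nonneg, h4]
    positivity
  have hi : Integrable fun t => |hermiteh n t| * ‖f t‖ := i1.congr (ae_of_all _ fun t => by
    simp [norm_smul])
  refine (integral_mono hi (((i2.add (i3.const_mul _)).const_mul _).const_mul _) hle).trans_eq ?_
  rw [integral_const_mul, integral_const_mul, integral_add' i2 (i3.const_mul _), integral_const_mul,
    integral_hermiteh_mul_hermiteH]

theorem norm_integral_hermiteh_smul_le {f : ℝ → E} (hf : SubGaussian f) (hc : Continuous f)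
    (n : ℕ) : ‖∫ t, hermiteh n t • f t‖ ≤
      1 / hermiteNorm n *
        (1 / 2 * (1 + 1 / √Real.pi * ∫ t : ℝ, Real.exp (-t ^ 2) * ‖f t‖ ^ 2)) := by
  refine (norm_integral_le_integral_norm _).trans ?_
  simp only [norm_smul, Real.norm_eq_abs]
  exact integral_abs_hermiteh_mul_norm_le hf hc n

theorem integral_abs_hermiteh_le (n : ℕ) : ∫ t, |hermiteh n t| ≤ 1 / hermiteNorm n := by
  have := integral_abs_hermiteh_mul_norm_le (.const (1 : ℝ)) continuous_const n
  -- For `f = 1` the `n`-independent factor is exactly `(1 + 1) / 2 = 1`, which yields the sharp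
  -- constant needed in (i).
  have e : ∫ t : ℝ, Real.exp (-t ^ 2) = √Real.pi := by simpa using integral_gaussian 1
  simp only [norm_one, mul_one, one_pow, e] at this
  refine this.trans_eq ?_
  field_simp
  norm_num

end

/-! ### Decay of the normalized Hermite polynomials at a fixed point -/

theorem hermiteH_neg (n : ℕ) (t : ℝ) : hermiteH n (-t) = (-1) ^ n * hermiteH n t := by
  rw [hermiteH_eq, hermiteH_eq, gaussDeriv_neg, neg_sq]
  ring

/-- Sonin's energy estimate for the Hermite functions. -/
theorem sonin_hermiteH (n : ℕ) (t : ℝ) :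
    (2 * (n + 1) + 1 - t ^ 2) * (Real.exp (-t ^ 2) * hermiteH (n + 1) t ^ 2) ≤
      (2 * (n + 1) + 1) * hermiteH (n + 1) 0 ^ 2 + (2 * (n + 1) * hermiteH n 0) ^ 2 := by
  wlog ht : 0 ≤ t generalizing t
  · have := this (-t) (by linarith)
    rw [neg_sq, hermiteH_neg, mul_pow, ← pow_mul, mul_comm (n + 1) 2, pow_mul, neg_one_sq,
      one_pow, one_mul] at this
    exact this
  -- With `N = n + 1` and `u = e^{-s²/2} H_N`, which solves `u'' + (2N + 1 - s²) u = 0`, this is the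
  -- energy `(2N + 1 - s²) u² + u'²`. Its derivative `-2 s u²` is nonpositive for `s ≥ 0`.
  set F : ℝ → ℝ := fun s => Real.exp (-s ^ 2) *
    ((2 * (n + 1) + 1 - s ^ 2) * hermiteH (n + 1) s ^ 2 +
      (2 * (n + 1) * hermiteH n s - s * hermiteH (n + 1) s) ^ 2) with hF
  have hd : ∀ s, HasDerivAt F (-2 * s * Real.exp (-s ^ 2) * hermiteH (n + 1) s ^ 2) s := fun s => by
    have h3 : HasDerivAt (fun s : ℝ => s ^ 2) (2 * s) s := by simpa using (hasDerivAt_pow 2 s)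
    have h1 := hasDerivAt_hermiteH_succ n s
    have h0 := hasDerivAt_hermiteH n s
    have hrec : 2 * (n : ℝ) * hermiteH (n - 1) s = 2 * s * hermiteH n s - hermiteH (n + 1) s := by
      cases n with
      | zero => simp [hermiteH_zero, hermiteH_one]
      | succ n =>
        rw [hermiteH_add_two]
        simp
    rw [hrec] at h0
    have := h3.fun_neg.exp.mul (((h3.const_sub (2 * ((n : ℝ) + 1) + 1)).mul (h1.pow 2)).add
      (((h0.const_mul (2 * ((n : ℝ) + 1))).sub ((hasDerivAt_id s).mul h1)).pow 2))
    refine this.congr_deriv ?_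
    simp
    ring
  have hanti : AntitoneOn F (Set.Ici 0) :=
    antitoneOn_of_deriv_nonpos (convex_Ici 0)
      (fun s _ => (hd s).continuousAt.continuousWithinAt)
      (fun s _ => (hd s).differentiableAt.differentiableWithinAt) fun s hs => by
        rw [interior_Ici] at hs
        rw [(hd s).deriv]
        have : 0 ≤ s * Real.exp (-s ^ 2) * hermiteH (n + 1) s ^ 2 := by
          have := le_of_lt (Set.mem_Ioi.1 hs)
          positivity
        linarith
  have h0 := hanti (Set.mem_Ici.2 le_rfl) (Set.mem_Ici.2 ht) ht
  have h1 : F 0 = (2 * (n + 1) + 1) * hermiteH (n + 1) 0 ^ 2 + (2 * (n + 1) * hermiteH n 0) ^ 2 := by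
    simp [hF]
  rw [← h1]
  refine le_trans ?_ h0
  have : 0 ≤ Real.exp (-t ^ 2) *
    (2 * (n + 1) * hermiteH n t - t * hermiteH (n + 1) t) ^ 2 := by positivity
  simp only [hF]
  linarith

theorem hermiteH_odd_zero (n : ℕ) : hermiteH (2 * n + 1) 0 = 0 := by
  have := hermiteH_neg (2 * n + 1) 0
  rw [neg_zero, pow_succ, pow_mul] at this
  norm_num at this
  linarith

/-- The normalized squares at `0` have the Wallis ratio `(2n+1)/(2n+2)`, so the induction reduces to
`(2n+1)(2n+3) ≤ (2n+2)²`. -/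
theorem sq_hermiteH_even_zero_le (n : ℕ) :
    ((2 * n + 1) * (hermiteH (2 * n) 0 ^ 2 / hermiteNorm (2 * n) ^ 2) ^ 2 : ℝ) ≤ 1 := by
  induction n with
  | zero => simp [hermiteH_zero, hermiteNorm]
  | succ n ih =>
    have e : hermiteH (2 * (n + 1)) 0 ^ 2 / hermiteNorm (2 * (n + 1)) ^ 2 =
        (2 * n + 1) / (2 * n + 2) * (hermiteH (2 * n) 0 ^ 2 / hermiteNorm (2 * n) ^ 2) := by
      rw [show 2 * (n + 1) = 2 * n + 2 by ring, hermiteH_add_two, sq_hermiteNorm, sq_hermiteNorm,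
        Nat.factorial_succ, Nat.factorial_succ]
      push_cast
      field_simp
      ring
    rw [e, mul_pow]
    refine le_trans ?_ ih
    rw [← mul_assoc]
    refine mul_le_mul_of_nonneg_right ?_ (by positivity)
    rw [div_pow, ← mul_div_assoc, div_le_iff₀ (by positivity)]
    push_cast
    nlinarith [(by positivity : (0 : ℝ) ≤ n)]

/-- At the origin the normalized Hermite polynomials are `O(n^{-1/4})`. -/
theorem sq_hermiteH_zero_div_le (n : ℕ) :
    hermiteH n 0 ^ 2 / hermiteNorm n ^ 2 ≤ 1 / √(n + 1) := by
  rcases Nat.even_or_odd' n with ⟨k, rfl | rfl⟩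
  · have := sq_hermiteH_even_zero_le k
    refine (sq_le_sq₀ (by positivity) (by positivity)).1 ?_
    rw [div_pow 1, one_pow, Real.sq_sqrt (by positivity), le_div_iff₀ (by positivity), mul_comm]
    push_cast
    exact this
  · rw [hermiteH_odd_zero]
    simp

/-- Sonin's estimate transports the decay at the origin to any `t`, at the price of the factor
`e^{t²}`. -/
theorem tendsto_hermiteH_div_hermiteNorm (t : ℝ) :
    Tendsto (fun n => hermiteH n t / hermiteNorm n) atTop (𝓝 0) := by
  rw [← tendsto_add_atTop_iff_nat 1]
  suffices h : Tendsto (fun n : ℕ => (hermiteH (n + 1) t / hermiteNorm (n + 1)) ^ 2) atTop (𝓝 0) by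
    have := h.sqrt
    simp only [Real.sqrt_sq_eq_abs, Real.sqrt_zero] at this
    exact (tendsto_zero_iff_abs_tendsto_zero _).2 this
  have hlim : Tendsto (fun n : ℕ => Real.exp (t ^ 2) * (8 * (1 / √((n : ℝ) + 1)))) atTop (𝓝 0) := by
    have h1 : Tendsto (fun n : ℕ => √((n : ℝ) + 1)) atTop atTop :=
      Real.tendsto_sqrt_atTop.comp (tendsto_natCast_atTop_atTop.atTop_add tendsto_const_nhds)
    have h2 := (h1.const_div_atTop 1).const_mul 8 |>.const_mul (Real.exp (t ^ 2))
    simpa using h2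
  refine squeeze_zero' (Eventually.of_forall fun n => sq_nonneg _) ?_ hlim
  -- Once `n ≥ t²`, the coefficient `2(n+1) + 1 - t²` in Sonin's estimate is at least `n + 1`;
  -- dividing by it leaves a multiple of `1 / √(n+1)`.
  filter_upwards [eventually_ge_atTop (⌈t ^ 2⌉₊)] with n hn
  have hn' : t ^ 2 ≤ n := (Nat.le_ceil _).trans (by exact_mod_cast hn)
  have hs := sonin_hermiteH n t
  have hNe : hermiteNorm (n + 1) ^ 2 = 2 * (n + 1) * hermiteNorm n ^ 2 := by
    rw [sq_hermiteNorm, sq_hermiteNorm, Nat.factorial_succ]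
    push_cast
    ring
  have hp := pow_pos (hermiteNorm_pos n) 2
  have b0 := sq_hermiteH_zero_div_le n
  have b1 := sq_hermiteH_zero_div_le (n + 1)
  have b1' : hermiteH (n + 1) 0 ^ 2 / hermiteNorm (n + 1) ^ 2 ≤ 1 / √((n : ℝ) + 1) := by
    refine b1.trans ?_
    gcongr
    linarith
  set r := 1 / √((n : ℝ) + 1)
  rw [div_le_iff₀ hp] at b0
  rw [div_le_iff₀ (by rw [hNe]; positivity), hNe] at b1'
  rw [div_pow, hNe, div_le_iff₀ (by positivity)]
  have hE : Real.exp (t ^ 2) * Real.exp (-t ^ 2) = 1 := by rw [← Real.exp_add]; simp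
  have hpos := Real.exp_pos (t ^ 2)
  have hr : 0 ≤ r := by positivity
  set a := Real.exp (-t ^ 2) * hermiteH (n + 1) t ^ 2 with ha
  have ha0 : 0 ≤ a := by positivity
  have haa : hermiteH (n + 1) t ^ 2 = Real.exp (t ^ 2) * a := by
    rw [ha, ← mul_assoc, hE, one_mul]
  rw [haa, mul_assoc]
  refine mul_le_mul_of_nonneg_left ?_ hpos.le
  have h1 : ((n : ℝ) + 1) * a ≤ (2 * (n + 1) + 1 - t ^ 2) * a :=
    mul_le_mul_of_nonneg_right (by linarith) ha0
  have h2 : (2 * ((n : ℝ) + 1) + 1) * hermiteH (n + 1) 0 ^ 2 ≤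
      (2 * ((n : ℝ) + 1) + 1) * (r * (2 * (n + 1) * hermiteNorm n ^ 2)) :=
    mul_le_mul_of_nonneg_left b1' (by positivity)
  have h3 : (2 * ((n : ℝ) + 1) * hermiteH n 0) ^ 2 ≤
      (2 * ((n : ℝ) + 1)) ^ 2 * (r * hermiteNorm n ^ 2) := by
    rw [mul_pow]
    exact mul_le_mul_of_nonneg_left b0 (by positivity)
  have h4 : ((n : ℝ) + 1) * a ≤ ((n : ℝ) + 1) * (8 * r * (2 * (n + 1) * hermiteNorm n ^ 2)) := by
    refine (h1.trans (hs.trans (add_le_add h2 h3))).trans ?_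
    have : 0 ≤ r * hermiteNorm n ^ 2 := by positivity
    have hn0 : (0 : ℝ) ≤ n := by positivity
    have e : ((n : ℝ) + 1) * (8 * r * (2 * (n + 1) * hermiteNorm n ^ 2)) -
      ((2 * ((n : ℝ) + 1) + 1) * (r * (2 * (n + 1) * hermiteNorm n ^ 2)) +
        (2 * ((n : ℝ) + 1)) ^ 2 * (r * hermiteNorm n ^ 2)) =
      (n + 1) * (8 * n + 6) * (r * hermiteNorm n ^ 2) := by ring
    rw [← sub_nonneg, e]
    positivity
  exact le_of_mul_le_mul_left h4 (by positivity)

/-! ### Pointwise convergence of Hermite expansions -/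

section
variable {E : Type*} [NormedAddCommGroup E] [NormedSpace ℝ E]

/-- The average over `[0, 1]` of `φ(r) f(t + r (s - t))`. -/
def segmentAverage (φ : ℝ → ℝ) (f : ℝ → E) (t s : ℝ) : E :=
  ∫ r in (0 : ℝ)..1, φ r • f (t + r * (s - t))

theorem continuous_segmentAverage {φ : ℝ → ℝ} {f : ℝ → E} (hφ : Continuous φ) (hf : Continuous f)
    (t : ℝ) : Continuous (segmentAverage φ f t) := by
  apply intervalIntegral.continuous_parametric_intervalIntegral_of_continuous'
  fun_prop

theorem SubGaussian.segmentAverage {φ : ℝ → ℝ} {f : ℝ → E} (hφ : ∀ r ∈ Set.Icc (0 : ℝ) 1, |φ r| ≤ 1)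
    (hf : SubGaussian f) (t : ℝ) : SubGaussian (segmentAverage φ f t) := by
  obtain ⟨K, hK, h⟩ := hf
  refine ⟨K * Real.exp (1 / 8 * t ^ 2), by positivity, fun s => ?_⟩
  have := intervalIntegral.norm_integral_le_of_norm_le_const (a := (0 : ℝ)) (b := 1)
    (f := fun r => φ r • f (t + r * (s - t)))
    (C := K * Real.exp (1 / 8 * t ^ 2) * Real.exp (1 / 8 * s ^ 2)) fun r hr => by
      rw [Set.uIoc_of_le zero_le_one] at hr
      rw [norm_smul]
      calc ‖φ r‖ * ‖f (t + r * (s - t))‖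
          ≤ 1 * (K * Real.exp (1 / 8 * (t + r * (s - t)) ^ 2)) :=
            mul_le_mul (hφ r ⟨hr.1.le, hr.2⟩) (h _) (norm_nonneg _) zero_le_one
        _ ≤ K * Real.exp (1 / 8 * t ^ 2 + 1 / 8 * s ^ 2) := by
          rw [one_mul]
          gcongr
          -- Convexity of the square: a point between `t` and `s` has square at most `t² + s²`.
          have h1 : (t + r * (s - t)) ^ 2 =
              (1 - r) * t ^ 2 + r * s ^ 2 - r * (1 - r) * (s - t) ^ 2 := by ring
          have h2 : 0 ≤ r * (1 - r) * (s - t) ^ 2 :=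
            mul_nonneg (mul_nonneg hr.1.le (by linarith [hr.2])) (sq_nonneg _)
          have h3 : 0 ≤ r * t ^ 2 := mul_nonneg hr.1.le (sq_nonneg _)
          have h4 : 0 ≤ (1 - r) * s ^ 2 := mul_nonneg (by linarith [hr.2]) (sq_nonneg _)
          linarith
        _ = _ := by rw [Real.exp_add]; ring
  rw [sub_zero, abs_one, mul_one] at this
  exact this

theorem hasDerivAt_segmentAverage {f f' : ℝ → E} (hd : ∀ t, HasDerivAt f (f' t) t)
    (hc : Continuous f') (t s : ℝ) :
    HasDerivAt (segmentAverage (fun _ => 1) f t) (segmentAverage (fun r => r) f' t s) s := by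
  have hcf : Continuous f := continuous_iff_continuousAt.2 fun t => (hd t).continuousAt
  obtain ⟨B, hB⟩ := ((isCompact_Icc (a := (0 : ℝ)) (b := 1)).prod
    (isCompact_closedBall s 1)).exists_bound_of_continuousOn
    (f := fun p : ℝ × ℝ => p.1 • f' (t + p.1 * (p.2 - t))) (by fun_prop)
  refine (intervalIntegral.hasDerivAt_integral_of_dominated_loc_of_deriv_le
    (F := fun u r => (1 : ℝ) • f (t + r * (u - t)))
    (F' := fun u r => r • f' (t + r * (u - t))) (bound := fun _ => B)
    (Metric.closedBall_mem_nhds s one_pos) (Eventually.of_forall fun u => ?_) ?_ ?_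
    (ae_of_all _ fun r hr u hu => ?_) intervalIntegrable_const
    (ae_of_all _ fun r hr u hu => ?_)).2
  · exact (by fun_prop : Continuous fun r => (1 : ℝ) • f (t + r * (u - t))).aestronglyMeasurable
  · exact (by fun_prop : Continuous fun r => (1 : ℝ) • f (t + r * (s - t))).intervalIntegrable 0 1
  · exact (by fun_prop : Continuous fun r => r • f' (t + r * (s - t))).aestronglyMeasurable
  · rw [Set.uIoc_of_le zero_le_one] at hr
    exact hB (r, u) ⟨⟨hr.1.le, hr.2⟩, hu⟩
  · have h1 : HasDerivAt (fun u : ℝ => t + r * (u - t)) r u := by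
      simpa using (((hasDerivAt_id u).sub_const t).const_mul r).const_add t
    simp only [one_smul]
    exact (hd _).scomp u h1

variable [CompleteSpace E]

/-- Hadamard's lemma: the average of `f'` over the segment is the divided difference of `f`,
extended across `s = t`. In this form it inherits smoothness and growth bounds from `f'`. -/
theorem sub_eq_smul_segmentAverage {f f' : ℝ → E} (hd : ∀ t, HasDerivAt f (f' t) t)
    (hc : Continuous f') (t s : ℝ) : f s - f t = (s - t) • segmentAverage (fun _ => 1) f' t s := by
  have hder : ∀ r ∈ Set.uIcc (0 : ℝ) 1,
      HasDerivAt (fun r => f (t + r * (s - t))) ((s - t) • f' (t + r * (s - t))) r := fun r _ => by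
    have h1 : HasDerivAt (fun r : ℝ => t + r * (s - t)) (s - t) r := by
      simpa using ((hasDerivAt_id r).mul_const (s - t)).const_add t
    exact (hd _).scomp r h1
  have := intervalIntegral.integral_eq_sub_of_hasDerivAt hder
    ((by fun_prop : Continuous fun r => (s - t) • f' (t + r * (s - t))).intervalIntegrable 0 1)
  rw [intervalIntegral.integral_smul] at this
  simp only [segmentAverage, one_smul]
  rw [this]
  simp

/-- **Pointwise convergence of the Hermite expansion** of a twice continuously differentiable
function. -/
theorem tendsto_hermite_expansion {f f' f'' : ℝ → E} (hd : ∀ t, HasDerivAt f (f' t) t)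
    (hd' : ∀ t, HasDerivAt f' (f'' t) t) (hc'' : Continuous f'') (hf : SubGaussian f)
    (hf' : SubGaussian f') (hf'' : SubGaussian f'') (t : ℝ) :
    Tendsto (fun m : ℕ => ∑ k ∈ Finset.range m, hermiteH k t • ∫ s, hermiteh k s • f s)
      atTop (𝓝 (f t)) := by
  have hc : Continuous f := continuous_iff_continuousAt.2 fun t => (hd t).continuousAt
  have hc' : Continuous f' := continuous_iff_continuousAt.2 fun t => (hd' t).continuousAt
  set g := segmentAverage (fun _ => 1) f' t with hg
  set g' := segmentAverage (fun r => r) f'' t with hg'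
  have gd : ∀ s, HasDerivAt g (g' s) s := hasDerivAt_segmentAverage hd' hc'' t
  have gs : SubGaussian g := hf'.segmentAverage (by simp) t
  have gs' : SubGaussian g' := hf''.segmentAverage
    (fun r hr => by rw [abs_of_nonneg hr.1]; exact hr.2) t
  have gc : Continuous g := continuous_segmentAverage continuous_const hc' t
  have gc' : Continuous g' := continuous_segmentAverage continuous_id hc'' t
  have hfs := fun k => hf.integrable_hermiteh_smul hc k
  have hgs := fun k => gs.integrable_hermiteh_smul gc k
  have hconst : ∀ k, ∫ s, hermiteh k s • f t = (if k = 0 then (1 : ℝ) else 0) • f t := fun k => by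
    rw [integral_smul_const]
    cases k with
    | zero => rw [integral_hermiteh_zero, if_pos rfl]
    | succ k => rw [integral_hermiteh_succ, if_neg (Nat.succ_ne_zero k)]
  -- Constants are reproduced exactly, so the error is the kernel integrated against `f s - f t = (s
  -- - t) • g s`. Christoffel-Darboux absorbs the factor `s - t`.
  have hrem : ∀ m : ℕ, ∑ k ∈ Finset.range (m + 1), hermiteH k t • ∫ s, hermiteh k s • f s =
      f t + ((((m : ℝ) + 1) * hermiteH m t) • ∫ s, hermiteh (m + 1) s • g s) -
        ((1 / 2 * hermiteH (m + 1) t) • ∫ s, hermiteh m s • g s) := fun m => by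
    have h1 : ∑ k ∈ Finset.range (m + 1), hermiteH k t • ∫ s, hermiteh k s • f t = f t := by
      rw [Finset.sum_eq_single 0]
      · rw [hconst, if_pos rfl, hermiteH_zero, one_smul, one_smul]
      · intro k _ hk
        rw [hconst, if_neg hk, zero_smul, smul_zero]
      · simp
    have h2 : (∑ k ∈ Finset.range (m + 1), hermiteH k t • ∫ s, hermiteh k s • f s) - f t =
        ∫ s, ∑ k ∈ Finset.range (m + 1), hermiteH k t • (hermiteh k s • (f s - f t)) := by
      have hi : ∀ k, Integrable fun s => hermiteh k s • (f s - f t) := fun k =>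
        (hf.sub (.const (f t))).integrable_hermiteh_smul (by fun_prop) k
      rw [integral_finsetSum _ fun k _ => (hi k).fun_smul _]
      nth_rewrite 1 [← h1]
      rw [← Finset.sum_sub_distrib]
      refine Finset.sum_congr rfl fun k _ => ?_
      rw [integral_smul, ← smul_sub,
        ← integral_sub (hfs k) ((SubGaussian.const (f t)).integrable_hermiteh_smul
          continuous_const k)]
      simp only [smul_sub]
    have h3 : ∀ s, ∑ k ∈ Finset.range (m + 1), hermiteH k t • (hermiteh k s • (f s - f t)) =
        (((m : ℝ) + 1) * hermiteH m t) • (hermiteh (m + 1) s • g s) -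
          (1 / 2 * hermiteH (m + 1) t) • (hermiteh m s • g s) := fun s => by
      simp only [smul_smul]
      rw [← Finset.sum_smul, sub_eq_smul_segmentAverage hd hc', ← hg, smul_smul, ← sub_smul,
        mul_comm, christoffel_darboux]
      congr 1
      ring
    rw [integral_congr_ae (ae_of_all _ h3), integral_sub ((hgs _).fun_smul _) ((hgs _).fun_smul _),
      integral_smul, integral_smul] at h2
    rw [← sub_eq_zero] at h2 ⊢
    rw [← h2]
    abel
  set L := 1 / 2 * (1 + 1 / √Real.pi * ∫ s : ℝ, Real.exp (-s ^ 2) * ‖g' s‖ ^ 2) with hL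
  have hint : ∀ k, ‖∫ s, hermiteh k s • g' s‖ ≤ 1 / hermiteNorm k * L := fun k =>
    norm_integral_hermiteh_smul_le gs' gc' k
  have hLnn : 0 ≤ L := by
    have := (norm_nonneg _).trans (hint 0)
    exact nonneg_of_mul_nonneg_right this (one_div_pos.2 (hermiteNorm_pos 0))
  have hφ := tendsto_hermiteH_div_hermiteNorm t
  -- Integration by parts cancels the factor `m + 1` and leaves `H_m(t) / 2` times a coefficient of
  -- `g'`, which is `O(1 / √(2^m m!))`.
  have t1 : Tendsto (fun m : ℕ => (((m : ℝ) + 1) * hermiteH m t) • ∫ s, hermiteh (m + 1) s • g s)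
      atTop (𝓝 0) := by
    refine squeeze_zero_norm (fun m => ?_)
      (by simpa using ((tendsto_zero_iff_abs_tendsto_zero _).1 hφ).mul_const (1 / 2 * L))
    rw [integral_hermiteh_succ_smul gd gs gs' gc', smul_smul, norm_smul]
    have e : ((m : ℝ) + 1) * hermiteH m t * (1 / (2 * ((m : ℝ) + 1))) = 1 / 2 * hermiteH m t := by
      field_simp
    rw [e]
    refine (mul_le_mul_of_nonneg_left (hint m) (norm_nonneg _)).trans_eq ?_
    rw [abs_div, abs_of_pos (hermiteNorm_pos m), norm_mul, Real.norm_eq_abs,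
      Real.norm_eq_abs, abs_of_pos (by norm_num : (0 : ℝ) < 1 / 2)]
    ring
  have t2 : Tendsto (fun m : ℕ => (1 / 2 * hermiteH (m + 1) t) • ∫ s, hermiteh m s • g s)
      atTop (𝓝 0) := by
    -- The shift provides an index `m + 1` to integrate by parts. The polynomial then has index `m +
    -- 2`, and `hN` below compares its norm with that of index `m`, using the `1 / (m + 1)` gained.
    rw [← tendsto_add_atTop_iff_nat 1]
    have hφ2 := (tendsto_add_atTop_iff_nat 2).2 ((tendsto_zero_iff_abs_tendsto_zero _).1 hφ)
    refine squeeze_zero_norm (fun m => ?_) (by simpa using hφ2.mul_const (2 * L))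
    rw [integral_hermiteh_succ_smul gd gs gs' gc', smul_smul, norm_smul]
    refine (mul_le_mul_of_nonneg_left (hint m) (norm_nonneg _)).trans ?_
    have hN : hermiteNorm (m + 1 + 1) ≤ 4 * ((m : ℝ) + 1) * hermiteNorm m := by
      refine (sq_le_sq₀ (hermiteNorm_pos _).le
        (mul_nonneg (by positivity) (hermiteNorm_pos _).le)).1 ?_
      rw [mul_pow, sq_hermiteNorm, sq_hermiteNorm, Nat.factorial_succ, Nat.factorial_succ]
      have : (0 : ℝ) ≤ 2 ^ m * (m.factorial : ℝ) := by positivity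
      have h0 : (0 : ℝ) ≤ m := by positivity
      have e : (4 * ((m : ℝ) + 1)) ^ 2 * (2 ^ m * (m.factorial : ℝ)) -
        2 ^ (m + 1 + 1) * (((m + 1 + 1) * ((m + 1) * m.factorial) : ℕ) : ℝ) =
        (m + 1) * (12 * m + 8) * (2 ^ m * (m.factorial : ℝ)) := by
          push_cast
          ring
      rw [← sub_nonneg, e]
      positivity
    have h0 := hermiteNorm_pos m
    have h2 := hermiteNorm_pos (m + 1 + 1)
    have e1 : ‖1 / 2 * hermiteH (m + 1 + 1) t * (1 / (2 * ((m : ℝ) + 1)))‖ =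
        |hermiteH (m + 1 + 1) t| / (4 * ((m : ℝ) + 1)) := by
      rw [norm_mul, norm_mul, Real.norm_eq_abs, Real.norm_eq_abs, Real.norm_eq_abs,
        abs_of_pos (by norm_num : (0 : ℝ) < 1 / 2),
        abs_of_pos (by positivity : 0 < 1 / (2 * ((m : ℝ) + 1)))]
      field_simp
      ring
    rw [e1, abs_div, abs_of_pos (hermiteNorm_pos (m + 2))]
    calc |hermiteH (m + 1 + 1) t| / (4 * ((m : ℝ) + 1)) * (1 / hermiteNorm m * L)
        = |hermiteH (m + 1 + 1) t| / (4 * ((m : ℝ) + 1) * hermiteNorm m) * L := by field_simp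
      _ ≤ |hermiteH (m + 1 + 1) t| / hermiteNorm (m + 1 + 1) * L := by gcongr
      _ ≤ |hermiteH (m + 1 + 1) t| / hermiteNorm (m + 1 + 1) * (2 * L) := by
        gcongr
        linarith
  rw [← tendsto_add_atTop_iff_nat 1]
  simp only [hrem]
  simpa using (tendsto_const_nhds.add t1).sub t2
end

/-! ### Antiderivatives and second differences -/

section
variable {E : Type*} [NormedAddCommGroup E] [NormedSpace ℝ E]

/-- Uniqueness of antiderivatives: the identities for `sine C` and `sineIntegral C` below follow by
differentiating in `t` and comparing values at `0`. -/
theorem eq_of_hasDerivAt_eq {f g f' g' : ℝ → E} (hf : ∀ t, HasDerivAt f (f' t) t)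
    (hg : ∀ t, HasDerivAt g (g' t) t) (h : ∀ t, f' t = g' t) (h0 : f 0 = g 0) (t : ℝ) :
    f t = g t := by
  have hd : ∀ t, HasDerivAt (fun t => f t - g t) 0 t := fun t => by
    simpa [h t] using (hf t).fun_sub (hg t)
  have := is_const_of_deriv_eq_zero (fun t => (hd t).differentiableAt) (fun t => (hd t).deriv) t 0
  rw [h0, sub_self] at this
  exact sub_eq_zero.1 this

/-- The mean value inequality applied twice in the step `r`. The vector `y` is left free: `y = q''
t` gives the limit of the second difference quotient, and `y = 0` a bound for dominated convergence.
-/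
theorem norm_second_difference_sub_le {q q' q'' : ℝ → E} (hd : ∀ t, HasDerivAt q (q' t) t)
    (hd' : ∀ t, HasDerivAt q' (q'' t) t) {t r ε : ℝ} {y : E}
    (h : ∀ u, |u - t| ≤ |r| → ‖q'' u - y‖ ≤ ε) :
    ‖q (t + r) + q (t - r) - (2 : ℝ) • q t - (r ^ 2) • y‖ ≤ 2 * ε * r ^ 2 := by
  wlog hr : 0 ≤ r generalizing r
  · have := this (r := -r) (by simpa using h) (by linarith)
    rwa [neg_sq, sub_neg_eq_add, ← sub_eq_add_neg, add_comm (q (t - r))] at this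
  have hε : 0 ≤ ε := (norm_nonneg _).trans (h t (by simp))
  have a1 : ∀ s : ℝ, HasDerivAt (fun s => t + s) 1 s := fun s => (hasDerivAt_id s).const_add t
  have a2 : ∀ s : ℝ, HasDerivAt (fun s => t - s) (-1) s := fun s => (hasDerivAt_id s).const_sub t
  have d1 : ∀ s, HasDerivAt (fun s => q' (t + s) - q' (t - s) - (2 * s) • y)
      (q'' (t + s) + q'' (t - s) - (2 : ℝ) • y) s := fun s => by
    have := (((hd' _).scomp s (a1 s)).sub ((hd' _).scomp s (a2 s))).sub
      (((hasDerivAt_id s).const_mul 2).smul_const y)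
    refine this.congr_deriv ?_
    simp
  have d0 : ∀ s, HasDerivAt (fun s => q (t + s) + q (t - s) - (2 : ℝ) • q t - (s ^ 2) • y)
      (q' (t + s) - q' (t - s) - (2 * s) • y) s := fun s => by
    have := ((((hd _).scomp s (a1 s)).add ((hd _).scomp s (a2 s))).sub
      (hasDerivAt_const s ((2 : ℝ) • q t))).sub ((hasDerivAt_pow 2 s).smul_const y)
    refine this.congr_deriv ?_
    simp [sub_eq_add_neg]
  have b1 : ∀ s ∈ Set.Icc 0 r, ‖q' (t + s) - q' (t - s) - (2 * s) • y‖ ≤ 2 * ε * r := by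
    intro s hs
    have := norm_image_sub_le_of_norm_deriv_le_segment' (a := 0) (b := r) (C := 2 * ε)
      (fun s _ => (d1 s).hasDerivWithinAt) (fun s hs => by
        have e : q'' (t + s) + q'' (t - s) - (2 : ℝ) • y =
            (q'' (t + s) - y) + (q'' (t - s) - y) := by rw [two_smul]; abel
        rw [e, two_mul]
        have hs' : |s| ≤ |r| := by rw [abs_of_nonneg hs.1, abs_of_nonneg hr]; exact hs.2.le
        exact (norm_add_le _ _).trans (add_le_add (h _ (by simpa using hs'))
          (h _ (by simpa using hs')))) s hs
    simp only [add_zero, sub_zero, sub_self, mul_zero, zero_smul] at this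
    exact this.trans (mul_le_mul_of_nonneg_left hs.2 (by positivity))
  have := norm_image_sub_le_of_norm_deriv_le_segment' (a := 0) (b := r) (C := 2 * ε * r)
      (fun s _ => (d0 s).hasDerivWithinAt) (fun s hs => b1 s ⟨hs.1, hs.2.le⟩) r ⟨hr, le_rfl⟩
  have e0 : q (t + 0) + q (t - 0) - (2 : ℝ) • q t - ((0 : ℝ) ^ 2) • y = 0 := by
    simp [two_smul]
  rw [e0, sub_zero, sub_zero] at this
  refine this.trans_eq (by ring)

theorem tendsto_second_difference {q q' q'' : ℝ → E} (hd : ∀ t, HasDerivAt q (q' t) t)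
    (hd' : ∀ t, HasDerivAt q' (q'' t) t) {t : ℝ} (hc : ContinuousAt q'' t) :
    Tendsto (fun r : ℝ => (1 / r ^ 2) • (q (t + r) + q (t - r) - (2 : ℝ) • q t)) (𝓝[≠] 0)
      (𝓝 (q'' t)) := by
  rw [Metric.tendsto_nhds]
  intro ε hε
  obtain ⟨δ, hδ, h⟩ := Metric.continuousAt_iff.1 hc (ε / 3) (by positivity)
  have hball : Metric.ball (0 : ℝ) δ ∈ 𝓝[≠] (0 : ℝ) :=
    mem_nhdsWithin_of_mem_nhds (Metric.ball_mem_nhds _ hδ)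
  filter_upwards [hball, self_mem_nhdsWithin] with r hr hr0
  have hr0 : r ≠ 0 := hr0
  have hr' : |r| < δ := by simpa using hr
  have := norm_second_difference_sub_le hd hd' (t := t) (r := r) (ε := ε / 3) (y := q'' t)
    fun u hu => by
      rw [← dist_eq_norm]
      exact (h (by rw [Real.dist_eq]; exact hu.trans_lt hr')).le
  have e : (1 / r ^ 2) • (q (t + r) + q (t - r) - (2 : ℝ) • q t) - q'' t =
      (1 / r ^ 2) • (q (t + r) + q (t - r) - (2 : ℝ) • q t - (r ^ 2) • q'' t) := by
    rw [smul_sub _ _ ((r ^ 2) • q'' t), smul_smul]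
    have : 1 / r ^ 2 * r ^ 2 = 1 := by field_simp
    rw [this, one_smul]
  rw [dist_eq_norm, e, norm_smul, Real.norm_of_nonneg (by positivity)]
  calc _ ≤ 1 / r ^ 2 * (2 * (ε / 3) * r ^ 2) := by gcongr
    _ = 2 / 3 * ε := by field_simp
    _ < ε := by linarith
end

/-! ### Cosine functions: growth, sine function, and Taylor's formula on the domain of the generator
-/

namespace HermiteCosine
variable {X : Type*} [NormedAddCommGroup X] [NormedSpace ℂ X] {C : ℝ → X →L[ℂ] X}

namespace IsCosineFunction

theorem zero_apply (hC : IsCosineFunction C) (x : X) : C 0 x = x := by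
  rw [hC.map_zero, one_apply_eq_self]

theorem add_apply_sub (hC : IsCosineFunction C) (t s : ℝ) (x : X) :
    C (t + s) x + C (t - s) x = (2 : ℝ) • C t (C s x) := by
  have := congrArg (fun T : X →L[ℂ] X => T x) (hC.map_add_add_map_sub t s)
  simpa [two_smul] using this

theorem neg_apply (hC : IsCosineFunction C) (t : ℝ) (x : X) : C (-t) x = C t x := by
  have := hC.add_apply_sub 0 t x
  rw [hC.zero_apply, zero_add, zero_sub, two_smul] at this
  exact add_left_cancel this

theorem map_neg (hC : IsCosineFunction C) (t : ℝ) : C (-t) = C t :=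
  ContinuousLinearMap.ext (hC.neg_apply t)

theorem apply_apply (hC : IsCosineFunction C) (t s : ℝ) (x : X) :
    C t (C s x) = (1 / 2 : ℝ) • (C (t + s) x + C (t - s) x) := by
  rw [hC.add_apply_sub, smul_smul]
  norm_num

theorem apply_comm (hC : IsCosineFunction C) (t s : ℝ) (x : X) : C t (C s x) = C s (C t x) := by
  rw [hC.apply_apply, hC.apply_apply, add_comm t s, ← neg_sub s t, hC.neg_apply]

/-- Uniform boundedness gives `M ≥ 1` on `[0, 1]`; the recursion `C(t) = 2 C(t-1) C(1) - C(t-2)`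
then multiplies the bound by at most `2M + 1 ≤ 3M` per unit of time. -/
theorem exists_norm_le [CompleteSpace X] (hC : IsCosineFunction C) :
    ∃ M ω : ℝ, 0 ≤ M ∧ 0 ≤ ω ∧ ∀ t, ‖C t‖ ≤ M * Real.exp (ω * |t|) := by
  obtain ⟨M', hM'⟩ := banach_steinhaus (g := fun t : Set.Icc (0 : ℝ) 1 => C t) fun x => by
    obtain ⟨B, hB⟩ := (isCompact_Icc (a := (0 : ℝ)) (b := 1)).exists_bound_of_continuousOn
      (hC.continuous_apply x).continuousOn
    exact ⟨B, fun t => hB t t.2⟩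
  set M := max M' 1
  have hM1 : 1 ≤ M := le_max_right _ _
  have hM : ∀ t : ℝ, 0 ≤ t → t ≤ 1 → ‖C t‖ ≤ M := fun t h0 h1 =>
    (hM' ⟨t, h0, h1⟩).trans (le_max_left _ _)
  have key : ∀ (n : ℕ) (t : ℝ), |t| ≤ n + 1 → ‖C t‖ ≤ M * (3 * M) ^ n := by
    intro n
    induction n with
    | zero =>
      intro t ht
      rw [pow_zero, mul_one]
      rcases le_total 0 t with h | h
      · exact hM t h (by simpa [abs_of_nonneg h] using ht)
      · rw [← hC.map_neg]
        exact hM (-t) (by linarith) (by simpa [abs_of_nonpos h] using ht)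
    | succ n ih =>
      intro t ht
      wlog h0 : 0 ≤ t generalizing t
      · rw [← hC.map_neg]
        exact this (-t) (by rwa [abs_neg]) (by linarith)
      rw [abs_of_nonneg h0] at ht
      push_cast at ht
      have hP : 0 ≤ M * (3 * M) ^ n := by positivity
      rcases le_total t (n + 1) with h | h
      · refine (ih t (by rwa [abs_of_nonneg h0])).trans ?_
        rw [pow_succ]
        nlinarith
      · have hn : (0 : ℝ) ≤ n := by positivity
        have e : C t = (2 : ℂ) • (C (t - 1) * C 1) - C (t - 1 - 1) := by
          rw [← hC.map_add_add_map_sub, sub_add_cancel, add_sub_cancel_right]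
        have i1 := ih (t - 1) (abs_le.2 ⟨by linarith, by linarith⟩)
        have i2 := ih (t - 1 - 1) (abs_le.2 ⟨by linarith, by linarith⟩)
        have i3 := hM 1 zero_le_one le_rfl
        have i4 : ‖C (t - 1) * C 1‖ ≤ M * (3 * M) ^ n * M :=
          (norm_mul_le _ _).trans (mul_le_mul i1 i3 (norm_nonneg _) hP)
        rw [e]
        refine (norm_sub_le _ _).trans ?_
        rw [norm_smul, Complex.norm_ofNat, pow_succ]
        nlinarith
  refine ⟨M, Real.log (3 * M), by positivity, Real.log_nonneg (by linarith), fun t => ?_⟩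
  refine (key ⌊|t|⌋₊ t (Nat.lt_floor_add_one _).le).trans ?_
  gcongr
  rw [← Real.rpow_natCast, Real.rpow_def_of_pos (by positivity)]
  exact Real.exp_le_exp.2 (mul_le_mul_of_nonneg_left (Nat.floor_le (abs_nonneg t))
    (Real.log_nonneg (by linarith)))

end IsCosineFunction

/-- The second antiderivative `∫_0^t S(s) x ds` of the cosine function. -/
def sineIntegral (C : ℝ → X →L[ℂ] X) (t : ℝ) (x : X) : X := ∫ s in (0 : ℝ)..t, sine C s x

theorem sine_zero (x : X) : sine C 0 x = 0 := intervalIntegral.integral_same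

theorem sineIntegral_zero (x : X) : sineIntegral C 0 x = 0 := intervalIntegral.integral_same

theorem norm_sine_le {M ω : ℝ} (hM : 0 ≤ M) (hω : 0 ≤ ω)
    (h : ∀ t, ‖C t‖ ≤ M * Real.exp (ω * |t|)) (t : ℝ) (x : X) :
    ‖sine C t x‖ ≤ M * ‖x‖ * |t| * Real.exp (ω * |t|) := by
  have := intervalIntegral.norm_integral_le_of_norm_le_const (a := (0 : ℝ)) (b := t)
    (f := fun s => C s x) (C := M * Real.exp (ω * |t|) * ‖x‖) fun s hs => by
      refine ((C s).le_opNorm x).trans (mul_le_mul_of_nonneg_right ((h s).trans ?_) (norm_nonneg x))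
      have : |s| ≤ |t| := by
        rcases Set.mem_uIoc.1 hs with h | h
        · rw [abs_of_pos h.1, abs_of_pos (h.1.trans_le h.2)]
          exact h.2
        · rw [abs_of_nonpos h.2, abs_of_neg (h.1.trans_le h.2)]
          linarith
      gcongr
  rw [sub_zero] at this
  exact this.trans_eq (by ring)

namespace IsCosineFunction
variable [CompleteSpace X]

theorem hasDerivAt_sine (hC : IsCosineFunction C) (x : X) (t : ℝ) :
    HasDerivAt (fun t => sine C t x) (C t x) t :=
  (hC.continuous_apply x).integral_hasStrictDerivAt 0 t |>.hasDerivAt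

theorem continuous_sine (hC : IsCosineFunction C) (x : X) : Continuous fun t => sine C t x :=
  continuous_iff_continuousAt.2 fun t => (hC.hasDerivAt_sine x t).continuousAt

theorem hasDerivAt_sineIntegral (hC : IsCosineFunction C) (x : X) (t : ℝ) :
    HasDerivAt (fun t => sineIntegral C t x) (sine C t x) t :=
  (hC.continuous_sine x).integral_hasStrictDerivAt 0 t |>.hasDerivAt

theorem sine_neg (hC : IsCosineFunction C) (x : X) (t : ℝ) : sine C (-t) x = -sine C t x := by
  refine eq_of_hasDerivAt_eq (f := fun t => sine C (-t) x) (g := fun t => -sine C t x)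
    (fun t => (hC.hasDerivAt_sine x _).scomp t (hasDerivAt_neg t))
    (fun t => (hC.hasDerivAt_sine x t).fun_neg) (fun t => ?_) ?_ t
  · rw [hC.neg_apply, neg_one_smul]
  · simp [sine_zero]

theorem sineIntegral_neg (hC : IsCosineFunction C) (x : X) (t : ℝ) :
    sineIntegral C (-t) x = sineIntegral C t x := by
  refine eq_of_hasDerivAt_eq (f := fun t => sineIntegral C (-t) x)
    (g := fun t => sineIntegral C t x)
    (fun t => (hC.hasDerivAt_sineIntegral x _).scomp t (hasDerivAt_neg t))
    (fun t => hC.hasDerivAt_sineIntegral x t) (fun t => ?_) ?_ t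
  · rw [hC.sine_neg, neg_one_smul, neg_neg]
  · simp

theorem apply_sine (hC : IsCosineFunction C) (r t : ℝ) (x : X) :
    C r (sine C t x) = (1 / 2 : ℝ) • (sine C (t + r) x + sine C (t - r) x) := by
  refine eq_of_hasDerivAt_eq (f := fun t => C r (sine C t x))
    (g := fun t => (1 / 2 : ℝ) • (sine C (t + r) x + sine C (t - r) x))
    (fun t => ((C r).restrictScalars ℝ).hasFDerivAt.comp_hasDerivAt t (hC.hasDerivAt_sine x t))
    (fun t => (((hC.hasDerivAt_sine x _).comp_add_const t r).add
      ((hC.hasDerivAt_sine x _).comp_sub_const t r)).fun_const_smul _) (fun t => ?_) ?_ t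
  · rw [ContinuousLinearMap.coe_restrictScalars', hC.apply_comm, hC.apply_apply]
  · simp [sine_zero, hC.sine_neg]

/-- D'Alembert's equation integrated twice in `t`. The extra `sineIntegral C r x` is the constant of
integration, read off at `t = 0`. -/
theorem apply_sineIntegral (hC : IsCosineFunction C) (r t : ℝ) (x : X) :
    C r (sineIntegral C t x) + sineIntegral C r x =
      (1 / 2 : ℝ) • (sineIntegral C (t + r) x + sineIntegral C (t - r) x) := by
  refine eq_of_hasDerivAt_eq (f := fun t => C r (sineIntegral C t x) + sineIntegral C r x)
    (g := fun t => (1 / 2 : ℝ) • (sineIntegral C (t + r) x + sineIntegral C (t - r) x))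
    (fun t => (((C r).restrictScalars ℝ).hasFDerivAt.comp_hasDerivAt t
      (hC.hasDerivAt_sineIntegral x t)).add_const _)
    (fun t => (((hC.hasDerivAt_sineIntegral x _).comp_add_const t r).add
      ((hC.hasDerivAt_sineIntegral x _).comp_sub_const t r)).fun_const_smul _) (fun t => ?_) ?_ t
  · rw [ContinuousLinearMap.coe_restrictScalars', hC.apply_sine]
  · simp [sineIntegral_zero, hC.sineIntegral_neg, ← two_smul ℝ]

theorem sine_sub (hC : IsCosineFunction C) (t : ℝ) (x y : X) :
    sine C t (x - y) = sine C t x - sine C t y :=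
  eq_of_hasDerivAt_eq (hC.hasDerivAt_sine (x - y))
    (fun t => (hC.hasDerivAt_sine x t).fun_sub (hC.hasDerivAt_sine y t))
    (fun t => map_sub _ _ _) (by simp [sine_zero]) t

theorem sineIntegral_sub (hC : IsCosineFunction C) (t : ℝ) (x y : X) :
    sineIntegral C t (x - y) = sineIntegral C t x - sineIntegral C t y :=
  eq_of_hasDerivAt_eq (hC.hasDerivAt_sineIntegral (x - y))
    (fun t => (hC.hasDerivAt_sineIntegral x t).fun_sub (hC.hasDerivAt_sineIntegral y t))
    (fun t => hC.sine_sub t x y) (by simp [sineIntegral_zero]) t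

theorem sine_smul_apply_sub (hC : IsCosineFunction C) (c r t : ℝ) (x : X) :
    sine C t (c • (C r x - x)) = c • (C r (sine C t x) - sine C t x) := by
  refine eq_of_hasDerivAt_eq (hC.hasDerivAt_sine (c • (C r x - x)))
    (g := fun t => c • (C r (sine C t x) - sine C t x))
    (fun t => ((((C r).restrictScalars ℝ).hasFDerivAt.comp_hasDerivAt t
      (hC.hasDerivAt_sine x t)).sub (hC.hasDerivAt_sine x t)).fun_const_smul c)
    (fun t => ?_) (by simp [sine_zero]) t
  rw [ContinuousLinearMap.coe_restrictScalars', hC.apply_comm, ← map_sub]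
  exact ((C t).restrictScalars ℝ).map_smul c _

theorem sineIntegral_smul_apply_sub (hC : IsCosineFunction C) (c r t : ℝ) (x : X) :
    sineIntegral C t (c • (C r x - x)) = c • (C r (sineIntegral C t x) - sineIntegral C t x) := by
  refine eq_of_hasDerivAt_eq (hC.hasDerivAt_sineIntegral (c • (C r x - x)))
    (g := fun t => c • (C r (sineIntegral C t x) - sineIntegral C t x))
    (fun t => ((((C r).restrictScalars ℝ).hasFDerivAt.comp_hasDerivAt t
      (hC.hasDerivAt_sineIntegral x t)).sub (hC.hasDerivAt_sineIntegral x t)).fun_const_smul c)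
    (fun t => ?_) (by simp [sineIntegral_zero]) t
  rw [ContinuousLinearMap.coe_restrictScalars', hC.sine_smul_apply_sub]

theorem continuous_sineIntegral_apply (hC : IsCosineFunction C) (t : ℝ) :
    Continuous fun x => sineIntegral C t x := by
  obtain ⟨M, ω, hM, hω, h⟩ := hC.exists_norm_le
  have key : ∀ x, ‖sineIntegral C t x‖ ≤ M * |t| * Real.exp (ω * |t|) * |t| * ‖x‖ := fun x => by
    have := intervalIntegral.norm_integral_le_of_norm_le_const (a := (0 : ℝ)) (b := t)
      (f := fun s => sine C s x) (C := M * ‖x‖ * |t| * Real.exp (ω * |t|)) fun s hs => by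
        refine (norm_sine_le hM hω h s x).trans ?_
        have : |s| ≤ |t| := by
          rcases Set.mem_uIoc.1 hs with h | h
          · rw [abs_of_pos h.1, abs_of_pos (h.1.trans_le h.2)]
            exact h.2
          · rw [abs_of_nonpos h.2, abs_of_neg (h.1.trans_le h.2)]
            linarith
        gcongr
    rw [sub_zero] at this
    exact this.trans_eq (by ring)
  refine (LipschitzWith.of_dist_le_mul
    (K := (M * |t| * Real.exp (ω * |t|) * |t|).toNNReal) fun x y => ?_).continuous
  rw [dist_eq_norm, dist_eq_norm, ← hC.sineIntegral_sub, Real.coe_toNNReal _ (by positivity)]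
  exact key _

/-- On the domain of its generator, a cosine function is given by Taylor's formula. -/
theorem apply_eq_of_isGeneratorValue (hC : IsCosineFunction C) {x y : X}
    (h : IsGeneratorValue C x y) (t : ℝ) : C t x = x + sineIntegral C t y := by
  -- The double integral of `(2/r²)(C(r)x - x)` is computed twice as `r → 0`. By continuity it tends
  -- to the double integral of `y`. By the functional equation it is the second difference quotient
  -- of `sineIntegral C · x` at `t` minus the one at `0`, so it tends to `C t x - x`.
  have h1 := ((hC.continuous_sineIntegral_apply t).tendsto y).comp h
  have h2 := fun t : ℝ => tendsto_second_difference (hC.hasDerivAt_sineIntegral x)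
    (hC.hasDerivAt_sine x) (t := t) (hC.continuous_apply x).continuousAt
  have h3 := tendsto_nhds_unique (h1.congr fun r => ?_) ((h2 t).sub (h2 0))
  · rw [h3, hC.zero_apply, add_sub_cancel]
  · rw [Function.comp_apply, hC.sineIntegral_smul_apply_sub,
      eq_sub_of_add_eq (hC.apply_sineIntegral r t x), zero_add, zero_sub, hC.sineIntegral_neg,
      sineIntegral_zero]
    module

theorem hasDerivAt_of_isGeneratorValue (hC : IsCosineFunction C) {x y : X}
    (h : IsGeneratorValue C x y) (t : ℝ) : HasDerivAt (fun t => C t x) (sine C t y) t := by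
  have := (hC.hasDerivAt_sineIntegral y t).const_add x
  rwa [← show (fun t => C t x) = _ from funext (hC.apply_eq_of_isGeneratorValue h)] at this

theorem subGaussian_apply (hC : IsCosineFunction C) (x : X) : SubGaussian fun t => C t x := by
  obtain ⟨M, ω, hM, hω, h⟩ := hC.exists_norm_le
  refine .of_exp_bound (K := M * ‖x‖) (ω := ω) (by positivity) fun t => ?_
  refine ((C t).le_opNorm x).trans ((mul_le_mul_of_nonneg_right (h t) (norm_nonneg x)).trans_eq ?_)
  ring

theorem subGaussian_sine (hC : IsCosineFunction C) (x : X) : SubGaussian fun t => sine C t x := by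
  obtain ⟨M, ω, hM, hω, h⟩ := hC.exists_norm_le
  refine .of_exp_bound (K := M * ‖x‖) (ω := ω + 1) (by positivity) fun t => ?_
  refine (norm_sine_le hM hω h t x).trans ?_
  rw [add_mul, Real.exp_add, mul_assoc, mul_comm |t|, one_mul]
  have := Real.add_one_le_exp |t|
  gcongr
  linarith

end IsCosineFunction
end HermiteCosine

/-! ### Hermite coefficients of a cosine function and powers of the generator -/

theorem integral_eq_two_smul_integral_Ioi {E : Type*} [NormedAddCommGroup E] [NormedSpace ℝ E]
    {f : ℝ → E} (hf : Integrable f) (he : ∀ t, f (-t) = f t) :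
    ∫ t, f t = (2 : ℝ) • ∫ t in Set.Ioi (0 : ℝ), f t := by
  have h1 := integral_comp_neg_Iic 0 f
  simp only [he, neg_zero] at h1
  rw [← intervalIntegral.integral_Iic_add_Ioi (b := 0) hf.integrableOn hf.integrableOn, h1,
    two_smul]

theorem integral_eq_zero_of_odd {E : Type*} [NormedAddCommGroup E] [NormedSpace ℝ E]
    {f : ℝ → E} (h : ∀ t, f (-t) = -f t) : ∫ t, f t = 0 := by
  have h1 := integral_neg_eq_self f volume
  simp only [h, integral_neg] at h1
  have h2 : (2 : ℝ) • ∫ t, f t = 0 := by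
    rw [two_smul]
    nth_rewrite 1 [← h1]
    rw [neg_add_cancel]
  exact (smul_eq_zero.1 h2).resolve_left two_ne_zero

namespace HermiteCosine
variable {X : Type*} [NormedAddCommGroup X] [NormedSpace ℂ X] {C : ℝ → X →L[ℂ] X}

theorem IsGeneratorValue.mem_domain {x y : X} (h : IsGeneratorValue C x y) :
    x ∈ (generator C).domain := ⟨y, h⟩

theorem isGeneratorValue_generator (x : (generator C).domain) :
    IsGeneratorValue C x (generator C x) := x.2.choose_spec

theorem IsGeneratorValue.generator_eq {x y : X} (h : IsGeneratorValue C x y) :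
    generator C ⟨x, h.mem_domain⟩ = y :=
  (isGeneratorValue_generator ⟨x, h.mem_domain⟩).unique h

theorem IsGeneratorValue.real_smul {x y : X} (c : ℝ) (h : IsGeneratorValue C x y) :
    IsGeneratorValue C (c • x) (c • y) := h.smul (c : ℂ)

/-- The natural domain of `A^{n+1}`. -/
theorem opPow_succ_of_isGeneratorValue {n : ℕ} {x y : X}
    (hx : x ∈ (opPow (generator C) n).domain)
    (h : IsGeneratorValue C (opPow (generator C) n ⟨x, hx⟩) y) :
    ∃ hx' : x ∈ (opPow (generator C) (n + 1)).domain,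
      opPow (generator C) (n + 1) ⟨x, hx'⟩ = y :=
  ⟨⟨hx, h.mem_domain⟩, h.generator_eq⟩

namespace IsCosineFunction

theorem integral_hermiteh_add_smul (n : ℕ) (x : X) (r : ℝ) :
    ∫ t, hermiteh n (t + r) • C t x = ∫ t, hermiteh n t • C (t - r) x := by
  have := integral_add_right_eq_self (μ := volume) (fun t => hermiteh n t • C (t - r) x) r
  simpa using this

theorem integral_hermiteh_odd_smul (hC : IsCosineFunction C) (n : ℕ) (x : X) :
    ∫ t, hermiteh (2 * n + 1) t • C t x = 0 :=
  integral_eq_zero_of_odd fun t => by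
    rw [hermiteh_neg, hC.neg_apply, pow_succ, pow_mul]
    simp

theorem integral_norm_hermiteh_smul_le_iSup
    (hb : BddAbove (Set.range fun t : ℝ => ‖C t‖)) (n : ℕ) (x : X) :
    ∫ t, ‖hermiteh n t • C t x‖ ≤ (⨆ t : ℝ, ‖C t‖) * ‖x‖ * (1 / hermiteNorm n) := by
  have h0 : 0 ≤ ⨆ t : ℝ, ‖C t‖ := Real.iSup_nonneg fun t => norm_nonneg _
  calc ∫ t, ‖hermiteh n t • C t x‖
      ≤ ∫ t, ((⨆ t : ℝ, ‖C t‖) * ‖x‖) * |hermiteh n t| := by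
        refine integral_mono_of_nonneg (ae_of_all _ fun t => norm_nonneg _)
          ((integrable_hermiteh n).abs.const_mul _) (ae_of_all _ fun t => ?_)
        simp only [norm_smul, Real.norm_eq_abs]
        rw [mul_comm]
        gcongr
        exact ((C t).le_opNorm x).trans
          (mul_le_mul_of_nonneg_right (le_ciSup hb t) (norm_nonneg x))
    _ = (⨆ t : ℝ, ‖C t‖) * ‖x‖ * ∫ t, |hermiteh n t| := integral_const_mul _ _
    _ ≤ _ := by
      gcongr
      exact integral_abs_hermiteh_le n

variable [CompleteSpace X]

theorem integrable_hermiteh_smul (hC : IsCosineFunction C) (n : ℕ) (x : X) :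
    Integrable fun t => hermiteh n t • C t x :=
  (hC.subGaussian_apply x).integrable_hermiteh_smul (hC.continuous_apply x) n

theorem integrable_hermiteh_smul_sine (hC : IsCosineFunction C) (n : ℕ) (x : X) :
    Integrable fun t => hermiteh n t • sine C t x :=
  (hC.subGaussian_sine x).integrable_hermiteh_smul (hC.continuous_sine x) n

theorem integrable_hermiteh_add_smul (hC : IsCosineFunction C) (n : ℕ) (x : X) (r : ℝ) :
    Integrable fun t => hermiteh n (t + r) • C t x := by
  obtain ⟨K, hK, h⟩ := exists_abs_hermiteh_le n
  obtain ⟨L, hL, h'⟩ := hC.subGaussian_apply x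
  refine ((integrable_exp_neg_mul_sq (b := 1 / 8) (by norm_num)).const_mul
    (K * L * Real.exp (r ^ 2 / 2))).mono'
    (((continuous_hermiteh n).comp (continuous_add_const r)).smul
      (hC.continuous_apply x)).aestronglyMeasurable (ae_of_all _ fun t => ?_)
  rw [norm_smul, Real.norm_eq_abs]
  calc |hermiteh n (t + r)| * ‖C t x‖
      ≤ (K * Real.exp (-(1 / 2) * (t + r) ^ 2)) * (L * Real.exp (1 / 8 * t ^ 2)) :=
        mul_le_mul (h _) (h' t) (norm_nonneg _) (by positivity)
    _ = K * L * Real.exp (-(1 / 2) * (t + r) ^ 2 + 1 / 8 * t ^ 2) := by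
      rw [Real.exp_add]
      ring
    _ ≤ K * L * Real.exp (r ^ 2 / 2 + -(1 / 8) * t ^ 2) :=
      mul_le_mul_of_nonneg_left
        (Real.exp_le_exp.2 (by nlinarith [sq_nonneg (t + 2 * r)])) (by positivity)
    _ = _ := by
      rw [Real.exp_add]
      ring

/-- `C r (C t x)` is the mean of two translates of the orbit; translation invariance of Lebesgue
measure moves the translates onto the smooth kernel, so no regularity of `x` is needed. -/
theorem second_difference_integral (hC : IsCosineFunction C) (n : ℕ) (x : X) (r : ℝ) :
    (2 / r ^ 2) • (C r (∫ t, hermiteh n t • C t x) - ∫ t, hermiteh n t • C t x) =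
      ∫ t, ((1 / r ^ 2) • (hermiteh n (t + r) + hermiteh n (t - r) - (2 : ℝ) • hermiteh n t)) •
        C t x := by
  have hi := hC.integrable_hermiteh_smul n x
  have i1 := hC.integrable_hermiteh_add_smul n x r
  have i2 := hC.integrable_hermiteh_add_smul n x (-r)
  simp only [← sub_eq_add_neg] at i2
  have e : ∀ t, ((1 / r ^ 2) • (hermiteh n (t + r) + hermiteh n (t - r) -
      (2 : ℝ) • hermiteh n t)) • C t x = (1 / r ^ 2) • ((hermiteh n (t + r) • C t x +
        hermiteh n (t - r) • C t x) - (2 : ℝ) • (hermiteh n t • C t x)) := fun t => by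
    simp only [smul_eq_mul]
    module
  simp only [e]
  rw [integral_smul, integral_sub (i1.fun_add i2) (hi.fun_smul _), integral_add i1 i2, integral_smul]
  have s1 := integral_hermiteh_add_smul (C := C) n x r
  have s2 := integral_hermiteh_add_smul (C := C) n x (-r)
  simp only [← sub_eq_add_neg, sub_neg_eq_add] at s2
  have hs1 : Integrable fun t => hermiteh n t • C (t - r) x := by
    have := i1.comp_sub_right r
    simpa using this
  have hs2 : Integrable fun t => hermiteh n t • C (t + r) x := by
    have := i2.comp_add_right r
    simpa using this
  have key : ∫ t, hermiteh n t • C (t - r) x + hermiteh n t • C (t + r) x =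
      (2 : ℝ) • C r (∫ t, hermiteh n t • C t x) := by
    rw [← (C r).integral_comp_comm hi, ← integral_smul]
    refine integral_congr_ae (ae_of_all _ fun t => ?_)
    have h1 : C r (hermiteh n t • C t x) = hermiteh n t • C r (C t x) :=
      ((C r).restrictScalars ℝ).map_smul _ _
    simp only []
    rw [h1, smul_comm, hC.apply_comm r t, ← hC.add_apply_sub, smul_add, add_comm]
  rw [s1, s2, ← integral_add hs1 hs2, key]
  module

/-- The generator acts on the Hermite coefficients by shifting their index by `2`. -/
theorem isGeneratorValue_integral_hermiteh (hC : IsCosineFunction C) (n : ℕ) (x : X) :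
    IsGeneratorValue C (∫ t, hermiteh n t • C t x)
      ((4 * ((n : ℝ) + 1) * (n + 2)) • ∫ t, hermiteh (n + 2) t • C t x) := by
  have hd := hasDerivAt_hermiteh n
  have hd' : ∀ t, HasDerivAt (fun t => -2 * ((n : ℝ) + 1) * hermiteh (n + 1) t)
      (4 * ((n : ℝ) + 1) * (n + 2) * hermiteh (n + 2) t) t := fun t => by
    refine ((hasDerivAt_hermiteh (n + 1) t).const_mul (-2 * ((n : ℝ) + 1))).congr_deriv ?_
    push_cast
    ring
  have hc : Continuous fun t => 4 * ((n : ℝ) + 1) * (n + 2) * hermiteh (n + 2) t :=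
    continuous_const.mul (continuous_hermiteh _)
  obtain ⟨K, hK, h⟩ := exists_abs_hermiteh_le (n + 2)
  obtain ⟨L, hL, h'⟩ := hC.subGaussian_apply x
  set c : ℝ := 4 * ((n : ℝ) + 1) * (n + 2) with hcdef
  have hc0 : 0 ≤ c := by positivity
  rw [← integral_smul]
  simp only [smul_smul]
  refine Tendsto.congr (fun r => (hC.second_difference_integral n x r).symm) ?_
  refine tendsto_integral_filter_of_dominated_convergence
    (fun t => 2 * (c * K) * L * Real.exp (1 / 2) * Real.exp (-(1 / 8) * t ^ 2))
    (Eventually.of_forall fun r => ?_) ?_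
    ((integrable_exp_neg_mul_sq (by norm_num)).const_mul _) (ae_of_all _ fun t => ?_)
  · have h1 := continuous_hermiteh n
    have h2 := hC.continuous_apply x
    exact (by fun_prop : Continuous fun t => ((1 / r ^ 2) • (hermiteh n (t + r) +
      hermiteh n (t - r) - (2 : ℝ) • hermiteh n t)) • C t x).aestronglyMeasurable
  · have hball : Metric.closedBall (0 : ℝ) 1 ∈ 𝓝[≠] (0 : ℝ) :=
      mem_nhdsWithin_of_mem_nhds (Metric.closedBall_mem_nhds _ one_pos)
    filter_upwards [hball, self_mem_nhdsWithin] with r hr hr0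
    have hr0 : r ≠ 0 := hr0
    have hr1 : |r| ≤ 1 := by simpa using hr
    refine ae_of_all _ fun t => ?_
    -- For `|u - t| ≤ 1` one has `-u²/2 ≤ 1/2 - t²/4`, so the second derivative of the kernel is
    -- bounded near `t` uniformly in `r`, with decay that beats the growth `e^{t²/8}` of the orbit.
    have hsd := norm_second_difference_sub_le hd hd' (t := t) (r := r) (y := 0)
      (ε := c * (K * Real.exp (1 / 2 + -(1 / 4) * t ^ 2))) fun u hu => by
        rw [sub_zero, norm_mul, Real.norm_of_nonneg hc0]
        refine mul_le_mul_of_nonneg_left ((h u).trans ?_) hc0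
        refine mul_le_mul_of_nonneg_left (Real.exp_le_exp.2 ?_) hK
        have : (u - t) ^ 2 ≤ 1 := by
          rw [← sq_abs]
          exact pow_le_one₀ (abs_nonneg _) (hu.trans hr1)
        nlinarith [sq_nonneg (2 * (u - t) + t)]
    rw [smul_zero, sub_zero] at hsd
    rw [norm_smul, norm_smul, Real.norm_of_nonneg (by positivity : 0 ≤ 1 / r ^ 2)]
    calc _ ≤ 1 / r ^ 2 * (2 * (c * (K * Real.exp (1 / 2 + -(1 / 4) * t ^ 2))) * r ^ 2) *
          (L * Real.exp (1 / 8 * t ^ 2)) :=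
          mul_le_mul (mul_le_mul_of_nonneg_left hsd (by positivity)) (h' t) (norm_nonneg _)
            (by positivity)
      _ = 2 * (c * K) * L * (Real.exp (1 / 2 + -(1 / 4) * t ^ 2) * Real.exp (1 / 8 * t ^ 2)) := by
        field_simp
      _ = _ := by
        rw [mul_assoc (2 * (c * K) * L), ← Real.exp_add, ← Real.exp_add]
        ring_nf
  · exact (tendsto_second_difference hd hd' hc.continuousAt).smul_const _

theorem integral_hermiteh_even_smul_sine (hC : IsCosineFunction C) (n : ℕ) (x : X) :
    ∫ t, hermiteh (2 * n) t • sine C t x = 0 :=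
  integral_eq_zero_of_odd fun t => by
    rw [hermiteh_neg, hC.sine_neg, pow_mul]
    simp

theorem integral_hermiteh_succ_smul_sine (hC : IsCosineFunction C) (n : ℕ) (x : X) :
    ∫ t, hermiteh (n + 1) t • sine C t x =
      (1 / (2 * ((n : ℝ) + 1))) • ∫ t, hermiteh n t • C t x :=
  integral_hermiteh_succ_smul (hC.hasDerivAt_sine x) (hC.subGaussian_sine x)
    (hC.subGaussian_apply x) (hC.continuous_apply x) n

/-- The base vector is a variable `y` with an equation, so that the result applies to `T(1/4) x`
itself without rewriting inside the dependent domain proofs. -/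
theorem exists_opPow_eq (hC : IsCosineFunction C) {x y : X}
    (hy : y = ∫ t, hermiteh 0 t • C t x) (n : ℕ) :
    ∃ h : y ∈ (opPow (generator C) n).domain, opPow (generator C) n ⟨y, h⟩ =
      (2 ^ (2 * n) * ((2 * n).factorial : ℝ)) • ∫ t, hermiteh (2 * n) t • C t x := by
  induction n with
  | zero =>
    refine ⟨trivial, ?_⟩
    rw [mul_zero, pow_zero, Nat.factorial_zero, Nat.cast_one, one_mul, one_smul]
    exact hy
  | succ n ih =>
    obtain ⟨h, he⟩ := ih
    refine opPow_succ_of_isGeneratorValue h ?_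
    rw [he]
    have := (hC.isGeneratorValue_integral_hermiteh (2 * n) x).real_smul
      (2 ^ (2 * n) * ((2 * n).factorial : ℝ))
    rw [smul_smul] at this
    rw [show 2 * (n + 1) = 2 * n + 2 by ring]
    convert this using 2
    rw [show 2 * n + 2 = 2 * n + 1 + 1 by ring, Nat.factorial_succ, Nat.factorial_succ]
    push_cast
    ring

theorem integrable_subordIntegrand (hC : IsCosineFunction C) {z : ℂ} (hz : 0 < z.re) (x : X) :
    Integrable (subordIntegrand C z x) := by
  obtain ⟨M, ω, hM, hω, h⟩ := hC.exists_norm_le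
  set c := (1 / (4 * z)).re with hc
  have hz0 : z ≠ 0 := fun h => by simp [h] at hz
  have hcpos : 0 < c := by
    have h4 : 0 < (4 * z).re := by simpa using hz
    have h40 : 4 * z ≠ 0 := by simpa using hz0
    rw [hc, one_div, Complex.inv_re]
    exact div_pos h4 (Complex.normSq_pos.2 h40)
  refine ((integrable_exp_neg_mul_sq (b := c / 2) (by positivity)).const_mul
    (M * ‖x‖ * Real.exp (ω ^ 2 / (2 * c)))).mono' ?_ (ae_of_all _ fun t => ?_)
  · have h2 := hC.continuous_apply x
    exact (by fun_prop : Continuous fun t : ℝ =>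
      Complex.exp (-(t : ℂ) ^ 2 / (4 * z)) • C t x).aestronglyMeasurable
  · have hre : (-(t : ℂ) ^ 2 / (4 * z)).re = -c * t ^ 2 := by
      have : -(t : ℂ) ^ 2 / (4 * z) = ((-t ^ 2 : ℝ) : ℂ) * (1 / (4 * z)) := by
        push_cast
        ring
      rw [this, Complex.re_ofReal_mul]
      ring
    rw [subordIntegrand, norm_smul, Complex.norm_exp, hre]
    calc Real.exp (-c * t ^ 2) * ‖C t x‖
        ≤ Real.exp (-c * t ^ 2) * (M * Real.exp (ω * |t|) * ‖x‖) := by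
          gcongr
          exact ((C t).le_opNorm x).trans (mul_le_mul_of_nonneg_right (h t) (norm_nonneg x))
      _ = M * ‖x‖ * Real.exp (-c * t ^ 2 + ω * |t|) := by
        rw [Real.exp_add]
        ring
      _ ≤ M * ‖x‖ * Real.exp (ω ^ 2 / (2 * c) + -(c / 2) * t ^ 2) := by
        refine mul_le_mul_of_nonneg_left (Real.exp_le_exp.2 ?_) (by positivity)
        have h1 : 0 ≤ c / 2 * (|t| - ω / c) ^ 2 := by positivity
        have h2 : c / 2 * (|t| - ω / c) ^ 2 = c / 2 * |t| ^ 2 - ω * |t| + ω ^ 2 / (2 * c) := by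
          field_simp
          ring
        rw [h2, sq_abs] at h1
        linarith
      _ = _ := by
        rw [Real.exp_add]
        ring

/-- The integrand is even, so the half-line integral is half of the one over the line, where the
Hermite functions live. -/
theorem subordSemigroup_eq (hC : IsCosineFunction C) {z : ℂ} (hz : 0 < z.re) (x : X) :
    subordSemigroup C z x =
      ∫ t : ℝ, (1 / (2 * ((Real.pi : ℂ) * z) ^ (1 / 2 : ℂ)) *
        Complex.exp (-(t : ℂ) ^ 2 / (4 * z))) • C t x := by
  have h := integral_eq_two_smul_integral_Ioi (hC.integrable_subordIntegrand hz x) fun t => by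
    rw [subordIntegrand, subordIntegrand, hC.neg_apply, Complex.ofReal_neg, neg_sq]
  have e : ∀ t : ℝ, (1 / (2 * ((Real.pi : ℂ) * z) ^ (1 / 2 : ℂ)) *
      Complex.exp (-(t : ℂ) ^ 2 / (4 * z))) • C t x =
      (1 / (2 * ((Real.pi : ℂ) * z) ^ (1 / 2 : ℂ))) • subordIntegrand C z x t := fun t =>
    mul_smul _ _ _
  simp only [e]
  rw [integral_smul, h, subordSemigroup, ← Complex.coe_smul, smul_smul]
  congr 1
  rw [Complex.ofReal_ofNat, ← div_div, div_right_comm, div_mul_cancel₀ _ two_ne_zero]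

theorem subordSemigroup_one_fourth (hC : IsCosineFunction C) (x : X) :
    subordSemigroup C (1 / 4) x = ∫ t, hermiteh 0 t • C t x := by
  rw [hC.subordSemigroup_eq (by norm_num)]
  refine integral_congr_ae (ae_of_all _ fun t => ?_)
  have h1 : ((Real.pi : ℂ) * (1 / 4)) ^ (1 / 2 : ℂ) = ((√Real.pi / 2 : ℝ) : ℂ) := by
    have : √Real.pi / 2 = (Real.pi * (1 / 4)) ^ (1 / 2 : ℝ) := by
      rw [← Real.sqrt_eq_rpow, Real.sqrt_mul Real.pi_pos.le,
        show (1 / 4 : ℝ) = (1 / 2) ^ 2 by norm_num, Real.sqrt_sq (by norm_num)]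
      ring
    rw [this, Complex.ofReal_cpow (by positivity)]
    norm_num
  have h2 : hermiteh 0 t = 1 / √Real.pi * Real.exp (-t ^ 2) := by simp [hermiteh, hermiteH_zero]
  simp only []
  rw [h1, h2, ← Complex.coe_smul]
  congr 1
  push_cast
  rw [show (2 : ℂ) * (((√Real.pi : ℝ) : ℂ) / 2) = ((√Real.pi : ℝ) : ℂ) by ring]
  congr 2
  ring

end IsCosineFunction
end HermiteCosine

/-! ### Fourier representation and the Mehler type series -/

theorem abs_pow_mul_exp_neg_le (k : ℕ) (ξ : ℝ) :
    |ξ| ^ k * Real.exp (-(1 / 4) * ξ ^ 2) ≤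
      k.factorial * Real.exp 2 * Real.exp (-(1 / 8) * ξ ^ 2) := by
  have h1 : |ξ| ^ k ≤ k.factorial * Real.exp |ξ| := by
    have := Real.pow_div_factorial_le_exp |ξ| (abs_nonneg ξ) k
    rwa [div_le_iff₀' (by positivity)] at this
  calc |ξ| ^ k * Real.exp (-(1 / 4) * ξ ^ 2)
      ≤ k.factorial * Real.exp |ξ| * Real.exp (-(1 / 4) * ξ ^ 2) := by gcongr
    _ = k.factorial * Real.exp (|ξ| + -(1 / 4) * ξ ^ 2) := by rw [Real.exp_add]; ring
    _ ≤ k.factorial * Real.exp (2 + -(1 / 8) * ξ ^ 2) :=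
      mul_le_mul_of_nonneg_left
        (Real.exp_le_exp.2 (by nlinarith [sq_nonneg (|ξ| - 4), sq_abs ξ])) (by positivity)
    _ = _ := by rw [Real.exp_add]; ring

/-- The integrand of the Fourier representation of `gaussDeriv k`. -/
def gaussFourier (k : ℕ) (t ξ : ℝ) : ℂ :=
  (Complex.I * ξ) ^ k * (Complex.exp (Complex.I * t * ξ) * Complex.exp (-(1 / 4) * (ξ : ℂ) ^ 2))

theorem norm_gaussFourier (k : ℕ) (t ξ : ℝ) :
    ‖gaussFourier k t ξ‖ = |ξ| ^ k * Real.exp (-(1 / 4) * ξ ^ 2) := by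
  have h1 : Complex.I * t * ξ = ((t * ξ : ℝ) : ℂ) * Complex.I := by push_cast; ring
  have h2 : -(1 / 4) * (ξ : ℂ) ^ 2 = ((-(1 / 4) * ξ ^ 2 : ℝ) : ℂ) := by push_cast; ring
  rw [gaussFourier, norm_mul, norm_mul, norm_pow, norm_mul, Complex.norm_I, one_mul, h1,
    Complex.norm_exp_ofReal_mul_I, h2, ← Complex.ofReal_exp, Complex.norm_real, Complex.norm_real,
    Real.norm_eq_abs, Real.norm_eq_abs, Real.abs_exp, one_mul]

theorem continuous_gaussFourier (k : ℕ) (t : ℝ) : Continuous (gaussFourier k t) := by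
  unfold gaussFourier
  fun_prop

theorem integrable_gaussFourier (k : ℕ) (t : ℝ) : Integrable (gaussFourier k t) :=
  ((integrable_exp_neg_mul_sq (b := 1 / 8) (by norm_num)).const_mul _).mono'
    (continuous_gaussFourier k t).aestronglyMeasurable
    (ae_of_all _ fun ξ => (norm_gaussFourier k t ξ).le.trans (abs_pow_mul_exp_neg_le k ξ))

theorem hasDerivAt_integral_gaussFourier (k : ℕ) (t : ℝ) :
    HasDerivAt (fun t => ∫ ξ, gaussFourier k t ξ) (∫ ξ, gaussFourier (k + 1) t ξ) t := by
  refine (hasDerivAt_integral_of_dominated_loc_of_deriv_le (F := gaussFourier k)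
    (F' := gaussFourier (k + 1)) (s := Set.univ) univ_mem
    (Eventually.of_forall fun t => (continuous_gaussFourier k t).aestronglyMeasurable)
    (integrable_gaussFourier k t) (continuous_gaussFourier (k + 1) t).aestronglyMeasurable
    (ae_of_all _ fun ξ u _ =>
      (norm_gaussFourier (k + 1) u ξ).le.trans (abs_pow_mul_exp_neg_le (k + 1) ξ))
    ((integrable_exp_neg_mul_sq (b := 1 / 8) (by norm_num)).const_mul _)
    (ae_of_all _ fun ξ u _ => ?_)).2
  have h1 : HasDerivAt (fun u : ℝ => Complex.I * (u : ℂ) * ξ) (Complex.I * ξ) u := by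
    simpa using ((Complex.ofRealCLM.hasDerivAt (x := u)).const_mul Complex.I).mul_const (ξ : ℂ)
  have := ((h1.cexp.mul_const (Complex.exp (-(1 / 4) * (ξ : ℂ) ^ 2))).const_mul
    ((Complex.I * ξ) ^ k))
  refine this.congr_deriv ?_
  rw [gaussFourier]
  ring

/-- The Gaussian is its own Fourier transform up to scaling; each derivative in `t` brings down a
factor `iξ`. -/
theorem gaussDeriv_eq_integral (k : ℕ) (t : ℝ) :
    (gaussDeriv k t : ℂ) = 1 / (2 * (√Real.pi : ℝ)) * ∫ ξ, gaussFourier k t ξ := by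
  induction k generalizing t with
  | zero =>
    have h := fourierIntegral_gaussian (b := 1 / 4) (by norm_num) t
    have e : ∀ ξ : ℝ, gaussFourier 0 t ξ =
        Complex.exp (Complex.I * t * ξ) * Complex.exp (-(1 / 4) * (ξ : ℂ) ^ 2) := fun ξ => by
      simp [gaussFourier]
    simp only [e]
    rw [h]
    have h1 : ((Real.pi : ℂ) / (1 / 4)) ^ (1 / 2 : ℂ) = ((2 * √Real.pi : ℝ) : ℂ) := by
      have : 2 * √Real.pi = (Real.pi / (1 / 4)) ^ (1 / 2 : ℝ) := by
        rw [← Real.sqrt_eq_rpow, Real.sqrt_div Real.pi_pos.le,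
          show (1 / 4 : ℝ) = (1 / 2) ^ 2 by norm_num, Real.sqrt_sq (by norm_num)]
        ring
      rw [this, Complex.ofReal_cpow (by positivity)]
      norm_num
    have h0 : (2 * (√Real.pi : ℝ) : ℂ) ≠ 0 := by
      simp [Real.pi_pos.le, Real.sqrt_eq_zero, Real.pi_ne_zero]
    rw [h1, gaussDeriv_zero, ← mul_assoc]
    push_cast
    rw [one_div_mul_cancel h0, one_mul]
    congr 1
    ring
  | succ k ih =>
    have h1 := (hasDerivAt_gaussDeriv k t).ofReal_comp
    have h2 := (hasDerivAt_integral_gaussFourier k t).const_mul (1 / (2 * (√Real.pi : ℝ)) : ℂ)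
    rw [show (fun t : ℝ => (gaussDeriv k t : ℂ)) = _ from funext ih] at h1
    exact h1.unique h2

theorem ofReal_mul_cpow {r : ℝ} (hr : 0 < r) {w : ℂ} (hw : w ≠ 0) (s : ℂ) :
    ((r : ℂ) * w) ^ s = (r : ℂ) ^ s * w ^ s := by
  have hr' : (r : ℂ) ≠ 0 := Complex.ofReal_ne_zero.2 hr.ne'
  rw [Complex.cpow_def_of_ne_zero (mul_ne_zero hr' hw), Complex.cpow_def_of_ne_zero hr',
    Complex.cpow_def_of_ne_zero hw, Complex.log_ofReal_mul hr hw, Complex.ofReal_log hr.le,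
    add_mul, Complex.exp_add]

/-- A Mehler type generating function for the Hermite functions of even order. -/
theorem hasSum_hermiteh_even {z : ℂ} (hz : ‖4 * z - 1‖ < 1) (t : ℝ) :
    HasSum (fun n : ℕ => (((2 * n).factorial : ℂ) / (n.factorial : ℂ) * (4 * z - 1) ^ n) *
      (hermiteh (2 * n) t : ℂ))
      (1 / (2 * ((Real.pi : ℂ) * z) ^ (1 / 2 : ℂ)) * Complex.exp (-(t : ℂ) ^ 2 / (4 * z))) := by
  set w := 4 * z - 1 with hw
  have hzre : 0 < z.re := by
    have h1 := (Complex.abs_re_le_norm w).trans_lt hz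
    rw [abs_lt, hw] at h1
    simp at h1
    linarith
  have hz0 : z ≠ 0 := fun h => by simp [h] at hzre
  have hpi : ((√Real.pi : ℝ) : ℂ) * ((√Real.pi : ℝ) : ℂ) = (Real.pi : ℂ) := by
    rw [← Complex.ofReal_mul, Real.mul_self_sqrt Real.pi_pos.le]
  have hsp : ((√Real.pi : ℝ) : ℂ) ≠ 0 := by
    rw [Complex.ofReal_ne_zero]
    positivity
  -- On the Fourier side the series is that of `e^{-wξ²/4}`, and `e^{-wξ²/4} e^{-ξ²/4} = e^{-zξ²}`
  -- because `w = 4z - 1`. The absolute values sum to `e^{-(1-|w|)ξ²/4}`, which is integrable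
  -- exactly because `|w| < 1`.
  have key : HasSum (fun n : ℕ => ∫ ξ : ℝ, (w ^ n / (4 ^ n * (n.factorial : ℂ))) *
      gaussFourier (2 * n) t ξ)
      (∫ ξ : ℝ, Complex.exp (Complex.I * t * ξ) * Complex.exp (-z * (ξ : ℂ) ^ 2)) := by
    have hexp : ∀ ξ : ℝ, HasSum (fun n : ℕ => (‖w‖ * ξ ^ 2 / 4) ^ n / (n.factorial : ℝ) *
        Real.exp (-(1 / 4) * ξ ^ 2)) (Real.exp (-((1 - ‖w‖) / 4) * ξ ^ 2)) := fun ξ => by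
      have := (NormedSpace.expSeries_div_hasSum_exp (‖w‖ * ξ ^ 2 / 4)).mul_right
        (Real.exp (-(1 / 4) * ξ ^ 2))
      rw [← Real.exp_eq_exp_ℝ, ← Real.exp_add] at this
      rwa [show ‖w‖ * ξ ^ 2 / 4 + -(1 / 4) * ξ ^ 2 = -((1 - ‖w‖) / 4) * ξ ^ 2 by ring] at this
    refine hasSum_integral_of_dominated_convergence
      (fun n ξ => (‖w‖ * ξ ^ 2 / 4) ^ n / (n.factorial : ℝ) * Real.exp (-(1 / 4) * ξ ^ 2))
      (fun n => (continuous_const.mul (continuous_gaussFourier _ t)).aestronglyMeasurable)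
      (fun n => ae_of_all _ fun ξ => ?_) (ae_of_all _ fun ξ => (hexp ξ).summable) ?_
      (ae_of_all _ fun ξ => ?_)
    · rw [norm_mul, norm_gaussFourier, norm_div, norm_mul, norm_pow, norm_pow, Complex.norm_ofNat,
        Complex.norm_natCast, pow_mul, sq_abs]
      refine le_of_eq ?_
      rw [div_pow, mul_pow]
      field_simp
    · simp only [fun ξ => (hexp ξ).tsum_eq]
      exact integrable_exp_neg_mul_sq (by linarith)
    · have := (NormedSpace.expSeries_div_hasSum_exp (-w * (ξ : ℂ) ^ 2 / 4)).mul_right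
        (Complex.exp (Complex.I * t * ξ) * Complex.exp (-(1 / 4) * (ξ : ℂ) ^ 2))
      rw [← Complex.exp_eq_exp_ℂ, mul_left_comm, ← Complex.exp_add (_ / 4)] at this
      rw [show -w * (ξ : ℂ) ^ 2 / 4 + -(1 / 4) * (ξ : ℂ) ^ 2 = -z * (ξ : ℂ) ^ 2 by
        rw [hw]
        ring] at this
      refine (congrArg (fun f : ℕ → ℂ => HasSum f _) (funext fun n => ?_)).mpr this
      have h1 : gaussFourier (2 * n) t ξ = (-(ξ : ℂ) ^ 2) ^ n *
          (Complex.exp (Complex.I * t * ξ) * Complex.exp (-(1 / 4) * (ξ : ℂ) ^ 2)) := by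
        rw [gaussFourier, pow_mul, mul_pow, Complex.I_sq, neg_one_mul]
      rw [h1, show -w * (ξ : ℂ) ^ 2 / 4 = w * (-(ξ : ℂ) ^ 2) / 4 by ring, div_pow, mul_pow]
      have : (n.factorial : ℂ) ≠ 0 := by exact_mod_cast (Nat.factorial_ne_zero _)
      field_simp
  have hmul := key.mul_left (1 / (2 * (Real.pi : ℂ)))
  have hval : 1 / (2 * ((Real.pi : ℂ) * z) ^ (1 / 2 : ℂ)) * Complex.exp (-(t : ℂ) ^ 2 / (4 * z)) =
      1 / (2 * (Real.pi : ℂ)) *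
        ∫ ξ : ℝ, Complex.exp (Complex.I * t * ξ) * Complex.exp (-z * (ξ : ℂ) ^ 2) := by
    rw [fourierIntegral_gaussian hzre, ← mul_assoc]
    congr 1
    -- As `Re z > 0`, `z` avoids the branch cut, so the principal roots of `πz` and `π/z` factor and
    -- agree with the normalization of `T(z)`.
    have harg : z.arg ≠ Real.pi := fun h => by
      rw [Complex.arg_eq_pi_iff] at h
      linarith [h.1]
    have hs : ((√Real.pi : ℝ) : ℂ) = (Real.pi : ℂ) ^ (1 / 2 : ℂ) := by
      rw [Real.sqrt_eq_rpow, Complex.ofReal_cpow Real.pi_pos.le]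
      norm_num
    have hzs : z ^ (1 / 2 : ℂ) ≠ 0 := by
      rw [Ne, Complex.cpow_eq_zero_iff]
      tauto
    have m1 : ((Real.pi : ℂ) * z) ^ (1 / 2 : ℂ) = ((√Real.pi : ℝ) : ℂ) * z ^ (1 / 2 : ℂ) := by
      rw [hs, ofReal_mul_cpow Real.pi_pos hz0]
    have m2 : ((Real.pi : ℂ) / z) ^ (1 / 2 : ℂ) = ((√Real.pi : ℝ) : ℂ) / z ^ (1 / 2 : ℂ) := by
      rw [hs, div_eq_mul_inv, ofReal_mul_cpow Real.pi_pos (inv_ne_zero hz0),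
        Complex.inv_cpow _ _ harg, ← div_eq_mul_inv]
    rw [m1, m2, ← hpi]
    field_simp
  rw [hval]
  refine (congrArg (fun f : ℕ → ℂ => HasSum f _) (funext fun n => ?_)).mpr hmul
  rw [integral_const_mul, hermiteh_eq, pow_mul, neg_one_sq, one_pow, pow_mul]
  push_cast
  rw [gaussDeriv_eq_integral, ← hpi]
  have : ((2 * n).factorial : ℂ) ≠ 0 := by exact_mod_cast (Nat.factorial_ne_zero _)
  have : (n.factorial : ℂ) ≠ 0 := by exact_mod_cast (Nat.factorial_ne_zero _)
  norm_num
  field_simp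

/-! ### Summation lemmas and the series for bounded cosine functions -/

theorem sum_range_two_mul {E : Type*} [AddCommMonoid E] (u : ℕ → E) (m : ℕ) :
    ∑ k ∈ Finset.range (2 * m), u k = ∑ n ∈ Finset.range m, (u (2 * n) + u (2 * n + 1)) := by
  induction m with
  | zero => simp
  | succ m ih =>
    rw [Finset.sum_range_succ, ← ih, show 2 * (m + 1) = 2 * m + 1 + 1 by ring,
      Finset.sum_range_succ, Finset.sum_range_succ, add_assoc]

theorem tendsto_two_mul_add_one : Tendsto (fun m : ℕ => 2 * (m + 1)) atTop atTop :=
  tendsto_atTop_mono (fun m => by omega : ∀ m : ℕ, m ≤ 2 * (m + 1)) tendsto_id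

/-- The square of the left side is the central binomial coefficient divided by `4^n`. -/
theorem factorial_two_mul_div_le (n : ℕ) :
    ((2 * n).factorial : ℝ) / n.factorial * (1 / hermiteNorm (2 * n)) ≤ 1 := by
  have hN := hermiteNorm_pos (2 * n)
  have hsq := sq_hermiteNorm (2 * n)
  have hn : (0 : ℝ) < n.factorial := by positivity
  rw [div_mul_div_comm, mul_one, div_le_one (by positivity)]
  refine (sq_le_sq₀ (by positivity) (by positivity)).1 ?_
  rw [mul_pow, hsq]
  have h1 : ((2 * n).factorial : ℝ) ≤ 2 ^ (2 * n) * (n.factorial : ℝ) ^ 2 := by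
    have h2 := Nat.choose_le_two_pow (2 * n) n
    have h3 := Nat.choose_mul_factorial_mul_factorial (show n ≤ 2 * n by omega)
    rw [show 2 * n - n = n by omega] at h3
    have h4 : (2 * n).factorial ≤ 2 ^ (2 * n) * n.factorial ^ 2 := by
      rw [← h3, mul_assoc, ← sq]
      exact Nat.mul_le_mul_right _ h2
    exact_mod_cast h4
  rw [sq ((2 * n).factorial : ℝ), ← mul_assoc, mul_comm ((n.factorial : ℝ) ^ 2)]
  exact mul_le_mul_of_nonneg_right h1 (by positivity)

namespace HermiteCosine
variable {X : Type*} [NormedAddCommGroup X] [NormedSpace ℂ X] {C : ℝ → X →L[ℂ] X}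

/-- The Mehler type series is integrated term by term against `C t x`. Boundedness of `C` and
`factorial_two_mul_div_le` dominate the `n`-th term by a multiple of `‖4z - 1‖ ^ n`. -/
theorem IsCosineFunction.hasSum_subordSemigroup [CompleteSpace X] (hC : IsCosineFunction C)
    (hb : BddAbove (Set.range fun t : ℝ => ‖C t‖)) {z : ℂ} (hz : ‖4 * z - 1‖ < 1) (x : X) :
    HasSum (fun n : ℕ => (((2 * n).factorial : ℂ) / (n.factorial : ℂ) * (4 * z - 1) ^ n) •
      ∫ t : ℝ, hermiteh (2 * n) t • C t x) (subordSemigroup C z x) := by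
  have hzre : 0 < z.re := by
    have h1 := (Complex.abs_re_le_norm _).trans_lt hz
    rw [abs_lt] at h1
    simp at h1
    linarith
  have h0 : 0 ≤ ⨆ t : ℝ, ‖C t‖ := Real.iSup_nonneg fun t => norm_nonneg _
  have hi := fun n => (hC.integrable_hermiteh_smul (2 * n) x).fun_smul
    (((2 * n).factorial : ℂ) / (n.factorial : ℂ) * (4 * z - 1) ^ n)
  have hsum := hasSum_integral_of_summable_integral_norm hi ?_
  · simp only [integral_smul] at hsum
    rw [hC.subordSemigroup_eq hzre]
    convert hsum using 1
    refine integral_congr_ae (ae_of_all _ fun t => ?_)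
    have := (hasSum_hermiteh_even hz t).smul_const (C t x)
    simp only []
    rw [← this.tsum_eq]
    refine tsum_congr fun n => ?_
    rw [mul_smul, Complex.coe_smul]
  · refine Summable.of_nonneg_of_le (fun n => integral_nonneg fun t => norm_nonneg _) (fun n => ?_)
      ((summable_geometric_of_lt_one (norm_nonneg _) hz).mul_left ((⨆ t : ℝ, ‖C t‖) * ‖x‖))
    simp only [norm_smul (((2 * n).factorial : ℂ) / (n.factorial : ℂ) * (4 * z - 1) ^ n)]
    rw [integral_const_mul]
    refine (mul_le_mul_of_nonneg_left
      (integral_norm_hermiteh_smul_le_iSup hb (2 * n) x) (norm_nonneg _)).trans ?_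
    rw [norm_mul, norm_div, norm_pow, Complex.norm_natCast, Complex.norm_natCast]
    calc ((2 * n).factorial : ℝ) / n.factorial * ‖4 * z - 1‖ ^ n *
          ((⨆ t : ℝ, ‖C t‖) * ‖x‖ * (1 / hermiteNorm (2 * n)))
        = ((2 * n).factorial : ℝ) / n.factorial * (1 / hermiteNorm (2 * n)) *
          ((⨆ t : ℝ, ‖C t‖) * ‖x‖ * ‖4 * z - 1‖ ^ n) := by ring
      _ ≤ 1 * ((⨆ t : ℝ, ‖C t‖) * ‖x‖ * ‖4 * z - 1‖ ^ n) :=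
        mul_le_mul_of_nonneg_right (factorial_two_mul_div_le n) (by positivity)
      _ = _ := one_mul _

end HermiteCosine

end

/-! ### Assembly of the theorem -/

theorem theorem4p1 {X : Type*} [NormedAddCommGroup X] [NormedSpace ℂ X] [CompleteSpace X]
    (C : ℝ → X →L[ℂ] X) (hC : IsCosineFunction C) :
    -- the integral defining `T(z) x` converges absolutely for `Re z > 0`
    (∀ z : ℂ, 0 < z.re → ∀ x : X, IntegrableOn (subordIntegrand C z x) (Set.Ioi 0)) ∧
    -- (i) the Hermite coefficients of `C` and `S`; all the integrals converge absolutely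
    (∀ (n : ℕ) (x : X), Integrable fun t : ℝ => hermiteh n t • C t x) ∧
    (∀ (n : ℕ) (x : X), Integrable fun t : ℝ => hermiteh n t • sine C t x) ∧
    (∀ (n : ℕ) (x : X), ∫ t : ℝ, hermiteh (2 * n + 1) t • C t x = 0) ∧
    (∀ (n : ℕ) (x : X), ∫ t : ℝ, hermiteh (2 * n) t • sine C t x = 0) ∧
    -- `T(1/4) x` lies in the domain of every power of the generator
    ∃ hT : ∀ (n : ℕ) (x : X),
        subordSemigroup C (1 / 4) x ∈ (opPow (generator C) n).domain,
      (∀ (n : ℕ) (x : X),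
        ∫ t : ℝ, hermiteh (2 * n) t • C t x =
          (1 / (2 ^ (2 * n) * ((2 * n).factorial : ℝ))) •
            opPow (generator C) n ⟨subordSemigroup C (1 / 4) x, hT n x⟩) ∧
      (∀ (n : ℕ) (x : X),
        ∫ t : ℝ, hermiteh (2 * n + 1) t • sine C t x =
          (1 / (2 ^ (2 * n + 1) * ((2 * n + 1).factorial : ℝ))) •
            opPow (generator C) n ⟨subordSemigroup C (1 / 4) x, hT n x⟩) ∧
      (BddAbove (Set.range fun t : ℝ => ‖C t‖) → ∀ (n : ℕ) (x : X),
        ‖opPow (generator C) n ⟨subordSemigroup C (1 / 4) x, hT n x⟩‖ ≤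
          (⨆ t : ℝ, ‖C t‖) * 2 ^ n * Real.sqrt ((2 * n).factorial : ℝ) * ‖x‖) ∧
      -- (ii) the Hermite expansions of `C` and `S`
      (∀ x ∈ (generator C).domain, ∀ t : ℝ,
        Tendsto (fun m : ℕ => ∑ n ∈ Finset.range (m + 1),
          (1 / (2 ^ (2 * n) * ((2 * n).factorial : ℝ)) * hermiteH (2 * n) t) •
            opPow (generator C) n ⟨subordSemigroup C (1 / 4) x, hT n x⟩)
          atTop (𝓝 (C t x))) ∧
      (∀ x ∈ (generator C).domain, ∀ t : ℝ,
        Tendsto (fun m : ℕ => ∑ n ∈ Finset.range (m + 1),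
          (1 / (2 ^ (2 * n + 1) * ((2 * n + 1).factorial : ℝ)) * hermiteH (2 * n + 1) t) •
            opPow (generator C) n ⟨subordSemigroup C (1 / 4) x, hT n x⟩)
          atTop (𝓝 (sine C t x))) ∧
      -- (iii) the series representation of `T(z)` for bounded `C`
      (BddAbove (Set.range fun t : ℝ => ‖C t‖) → ∀ (x : X) (z : ℂ), ‖z - 1 / 4‖ < 1 / 4 →
        Tendsto (fun m : ℕ => ∑ n ∈ Finset.range (m + 1),
          (1 / (2 ^ (2 * n) * (n.factorial : ℂ)) * (4 * z - 1) ^ n) •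
            opPow (generator C) n ⟨subordSemigroup C (1 / 4) x, hT n x⟩)
          atTop (𝓝 (subordSemigroup C z x))) := by
  have hT' := fun (n : ℕ) (x : X) => hC.exists_opPow_eq (hC.subordSemigroup_one_fourth x) n
  choose hT hA using hT'
  have hcoef : ∀ (n : ℕ) (x : X), ∫ t : ℝ, hermiteh (2 * n) t • C t x =
      (1 / (2 ^ (2 * n) * ((2 * n).factorial : ℝ))) •
        opPow (generator C) n ⟨subordSemigroup C (1 / 4) x, hT n x⟩ := fun n x => by
    rw [hA, smul_smul, one_div_mul_cancel (by positivity), one_smul]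
  have hcoefS : ∀ (n : ℕ) (x : X), ∫ t : ℝ, hermiteh (2 * n + 1) t • sine C t x =
      (1 / (2 ^ (2 * n + 1) * ((2 * n + 1).factorial : ℝ))) •
        opPow (generator C) n ⟨subordSemigroup C (1 / 4) x, hT n x⟩ := fun n x => by
    rw [hC.integral_hermiteh_succ_smul_sine, hcoef, smul_smul, Nat.factorial_succ]
    congr 1
    push_cast
    field_simp
    ring
  refine ⟨fun z hz x => (hC.integrable_subordIntegrand hz x).integrableOn,
    hC.integrable_hermiteh_smul, hC.integrable_hermiteh_smul_sine, hC.integral_hermiteh_odd_smul,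
    hC.integral_hermiteh_even_smul_sine, hT, hcoef, hcoefS, fun hb n x => ?_,
    fun x hx t => ?_, fun x hx t => ?_, fun hb x z hz => ?_⟩
  · rw [hA, norm_smul, Real.norm_of_nonneg (by positivity)]
    have h1 := (norm_integral_le_integral_norm _).trans
      (IsCosineFunction.integral_norm_hermiteh_smul_le_iSup hb (2 * n) x)
    refine (mul_le_mul_of_nonneg_left h1 (by positivity)).trans_eq ?_
    -- The factor `2^{2n} (2n)!` is the square of `hermiteNorm (2 * n)`; one power cancels against
    -- the bound on `∫ |h_{2n}|`, and the other equals `2^n √((2n)!)`.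
    rw [← sq_hermiteNorm]
    have h2 : hermiteNorm (2 * n) = 2 ^ n * √((2 * n).factorial : ℝ) := by
      rw [hermiteNorm, Real.sqrt_mul (by positivity), mul_comm 2 n, pow_mul,
        Real.sqrt_sq (by positivity)]
    have h3 := hermiteNorm_pos (2 * n)
    rw [mul_assoc (⨆ t : ℝ, ‖C t‖) (2 ^ n), ← h2]
    field_simp
  · have hx' := isGeneratorValue_generator ⟨x, hx⟩
    -- The orbit `C(t) x` has successive derivatives `S(t) A x` and `C(t) A x`.
    have := tendsto_hermite_expansion (hC.hasDerivAt_of_isGeneratorValue hx')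
      (hC.hasDerivAt_sine _) (hC.continuous_apply _) (hC.subGaussian_apply x)
      (hC.subGaussian_sine _) (hC.subGaussian_apply _) t
    -- Only partial sums of even length `2(m+1)` are used; pairing consecutive indices, the odd
    -- terms vanish by parity.
    refine (this.comp tendsto_two_mul_add_one).congr fun m => ?_
    rw [Function.comp_apply, sum_range_two_mul]
    refine Finset.sum_congr rfl fun n _ => ?_
    rw [hcoef, hC.integral_hermiteh_odd_smul, smul_zero, add_zero, smul_smul, mul_comm]
  · have hx' := isGeneratorValue_generator ⟨x, hx⟩
    -- Here the successive derivatives are `C(t) x` and `S(t) A x`; the second one is where `x ∈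
    -- D(A)` enters.
    have := tendsto_hermite_expansion (hC.hasDerivAt_sine x)
      (hC.hasDerivAt_of_isGeneratorValue hx') (hC.continuous_sine _) (hC.subGaussian_sine x)
      (hC.subGaussian_apply x) (hC.subGaussian_sine _) t
    refine (this.comp tendsto_two_mul_add_one).congr fun m => ?_
    rw [Function.comp_apply, sum_range_two_mul]
    refine Finset.sum_congr rfl fun n _ => ?_
    rw [hcoefS, hC.integral_hermiteh_even_smul_sine, smul_zero, zero_add, smul_smul, mul_comm]
  · have hw : ‖4 * z - 1‖ < 1 := by
      rw [show 4 * z - 1 = 4 * (z - 1 / 4) by ring, norm_mul, Complex.norm_ofNat]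
      linarith
    have := hC.hasSum_subordSemigroup hb hw x
    refine (this.tendsto_sum_nat.comp (tendsto_add_atTop_nat 1)).congr fun m => ?_
    refine Finset.sum_congr rfl fun n _ => ?_
    rw [hcoef, ← Complex.coe_smul, smul_smul]
    congr 1
    have h1 : ((2 * n).factorial : ℂ) ≠ 0 := by exact_mod_cast (Nat.factorial_ne_zero _)
    have h2 : (n.factorial : ℂ) ≠ 0 := by exact_mod_cast (Nat.factorial_ne_zero _)
    push_cast
    field_simp
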